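/- **Setting.** Let $X$ be a measurable space with measurable diagonal, $C$ a finite set of at least two classes, $p$ a probability measure on $X$ (the data distribution), $h:X\to C$ a measurable labelling, and assume that every class has positive probability $\rho(c)=p(h=c)>0$. Let $\nu$ be a reference measure on $X$ with the same null sets as $p$ (so that $p$ has a positive density with respect to $\nu$). Let $g_p:X\to\mathcal Z$ be measurable and let $\sigma(z,c)=1/(1+e^{-s(z,c)})$ be a sigmoid classifier with logits $s(\cdot,c)$ measurable and $\int\sigma(g_p(y),c)\,d\nu(y)<\infty$ for each $c$. Fix $d\ge1$ and $\tau>0$. An *embedding* is a measurable, nowhere vanishing $g:X\to\mathbb R^d$; put $\bar g=g/(\sqrt\tau\,\|g\|)$. For $x\in X$ let $p_x^+=p(\cdot\mid h=h(x))$ and, for $\beta>0$, let $q_\beta^-(\cdot\,;x)$ be the probability measure on $\{y:h(y)\ne h(x)\}$ proportional to $e^{\beta\bar g(x)\cdot\bar g(y)}\,\sigma(g_p(y),h(x))\,d\nu(y)$. For $Q>0$, $\alpha\ge0$ and $\gamma\in\mathbb R$, the SHARP objective is $$\mathcal L^{\gamma}_Q(g,\alpha,\beta)=\mathbb E_{x\sim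 p,\;x^+\sim p_x^+}\Big[-\log\frac{I_\alpha}{I_\alpha+II}\Big],\qquad II=Q\,\mathbb E_{x^-\sim q_\beta^-}\big[e^{\gamma\bar g(x)\cdot\bar g(x^-)}\big],$$ $$I_\alpha=e^{\bar g(x)\cdot\bar g(x^+)}+\alpha\,\mathbb E_{y\sim p_x^+}\big[e^{-\bar g(x)\cdot\bar g(y)}\,\big|\,y\notin\{x,x^+\}\big]$$ (the last expectation is read as $0$ if the conditioning event is null). Write $\mathcal L_Q=\mathcal L_Q^1$. For a family $q=(q_x)_{x\in X}$ of negative distributions, the unsupervised objective of Robinson et al. is $$\mathcal R_Q(g,q)=\mathbb E_{x\sim p,\;x^+\sim p_x^+}\Big[-\log\frac{e^{\bar g(x)\cdot\bar g(x^+)}}{e^{\bar g(x)\cdot\bar g(x^+)}+Q\,\mathbb E_{x^-\sim q_x}e^{\bar g(x)\cdot\bar g(x^-)}}\Big],$$ and $\mathcal R_Q(g,\beta)$ is its value for the hard negatives $q_x\propto e^{\beta\bar g(x)\cdot\bar g(y)}\,dp(y)$ on $\{h\neq h(x)\}$. Let $\bar{\mathcal L}_Q(g)=\sup_{\beta>0}\mathcal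 L_Q(g,0,\beta)$, $\bar{\mathcal R}_Q(g)=\sup_{\beta>0}\mathcal R_Q(g,\beta)$ and $$\bar{\mathcal L}_\infty(g)=\sup_{\beta>0}\mathbb E_{x\sim p,\;x^+\sim p_x^+}\Big[-\log\frac{e^{\bar g(x)\cdot\bar g(x^+)}}{\mathbb E_{x^-\sim q_\beta^-}e^{\bar g(x)\cdot\bar g(x^-)}}\Big].$$ A *configuration* is a family $v=(v_c)_{c\in C}$ of points of $\mathbb R^d$ with $\|v_c\|=1/\sqrt\tau$; let $\delta_c(v)=\min_{c'\ne c}\|v_c-v_{c'}\|$, $m(v)=\min_c\delta_c(v)$, and $$K_Q(v)=\sum_c\rho(c)\log\big(1+Qe^{-\delta_c(v)^2/2}\big),\qquad K_\infty(v)=-\tfrac12\sum_c\rho(c)\,\delta_c(v)^2 .$$ A configuration is an *$\varepsilon$-optimal packing* for $K$ if $K(v)\le K(v')+\varepsilon$ for all configurations $v'$, and an *optimal packing* if this holds with $\varepsilon=0$; so the optimal packings for $K_\infty$ are the configurations that maximise $\sum_c\rho(c)\min_{c'\ne c}\|v_c-v_{c'}\|^2$. **Theorem.** 1. (*Objective.*)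 For every embedding $g$ and all $Q>0$, $\alpha\ge0$, $\beta>0$: $\mathcal L^\gamma_Q(g,\alpha,\beta)\le\mathcal L^\gamma_Q(g,0,\beta)$ for every $\gamma\in\mathbb R$; $\mathcal L_Q(g,0,\beta)=\mathcal R_Q(g,q_\beta^-)$; $\mathcal L_Q(g,\alpha,\beta)\le\bar{\mathcal R}_Q(g)$; and if for each $c$ the measure $\sigma(g_p(y),c)\,d\nu(y)$ is a multiple of $p$, then $\mathcal L_Q(g,\alpha,\beta)\le\mathcal R_Q(g,\beta)$. 2. (*Hard negatives.*) For every embedding $g$ and all $Q>0$: $\bar{\mathcal L}_Q(g)=\bar{\mathcal R}_Q(g)$, and as $\beta\to\infty$, $\mathcal L_Q(g,0,\beta)\to\bar{\mathcal L}_Q(g)$ and $\mathcal R_Q(g,\beta)\to\bar{\mathcal R}_Q(g)$. Moreover $\bar{\mathcal L}_Q(g)-\log Q\to\bar{\mathcal L}_\infty(g)$ as $Q\to\infty$. 3. (*Packings and risk.*) Let $(F,K,\kappa)$ be $(\bar{\mathcal L}_Q,\,K_Q,\,1+e^{2/\tau}/Q)$ with $Q>0$, or $(\bar{\mathcal L}_\infty,\,K_\infty,\,1)$.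 Then: * $F$ attains its minimum over the embeddings, and an embedding $g$ is a minimiser if and only if there is an optimal packing $v$ for $K$ with $\bar g(x)=v_{h(x)}$ for $p$-almost every $x$. * If $\varepsilon\ge0$ and $g$ is an embedding with $F(g)\le F(g')+\varepsilon$ for all embeddings $g'$, then there is an $\varepsilon$-optimal packing $v$ for $K$ such that every nearest-neighbour classifier $\hat h(x)\in\arg\min_c\|\bar g(x)-v_c\|$ (ties broken arbitrarily) has misclassification risk satisfying $p(\hat h\ne h)\cdot m(v)^2\le8\kappa\varepsilon$. * If $\xi>0$ and every optimal packing $v$ for $K$ has $m(v)>\xi$, then there is $\varepsilon_0>0$ such that for all $0\le\varepsilon\le\varepsilon_0$ and every $g$ as in the previous item, the packing $v$ can be chosen so that $p(\hat h\ne h)\le8\kappa\varepsilon/\xi^2$ for every such $\hat h$. In particular, for $\varepsilon=0$ the risk is $0$. -/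

import Mathlib

open MeasureTheory ProbabilityTheory Filter Topology

noncomputable section

namespace SHARP

/-- Embedding functions: measurable and nowhere zero, so that they can be normalised. -/
structure IsEmbedding {X : Type*} [MeasurableSpace X] {d : ℕ}
    (g : X → EuclideanSpace ℝ (Fin d)) : Prop where
  measurable : Measurable g
  ne_zero : ∀ x, g x ≠ 0

/-- The normalised embedding `ḡ(x) = g(x) / (√τ ‖g(x)‖)`, with values in the sphere of
radius `1/√τ`. -/
def normalised {X : Type*} {d : ℕ} (τ : ℝ) (g : X → EuclideanSpace ℝ (Fin d)) (x : X) :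
    EuclideanSpace ℝ (Fin d) :=
  (√τ * ‖g x‖)⁻¹ • g x

/-- The positive distribution `p_x⁺`: the data distribution conditioned on the class of `x`. -/
def posDist {X C : Type*} [MeasurableSpace X] (p : Measure X) (h : X → C) (x : X) : Measure X :=
  cond p {y | h y = h x}

/-- The hard negative distribution of the anchor `x`: the normalised measure on
`{y | h y ≠ h x}` with density proportional to `exp (β ⟪f x, f y⟫)` with respect to the
measure `base (h x)`. -/
def hardNeg {X C : Type*} [MeasurableSpace X] {d : ℕ} (base : C → Measure X) (h : X → C)
    (f : X → EuclideanSpace ℝ (Fin d)) (β : ℝ) (x : X) : Measure X :=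
  ((base (h x)).restrict {y | h y ≠ h x}).tilted (fun y => β * inner ℝ (f x) (f y))

/-- The weighting `σ(g_p(y), c) dy` of the samples by the sigmoid classifier; `score z c` is the
logit at the representation `z`, `gp` the embedding on which the classifier acts, and `ν` the
reference measure `dy`. -/
def classifierBase {X Z C : Type*} [MeasurableSpace X] (ν : Measure X) (gp : X → Z)
    (score : Z → C → ℝ) (c : C) : Measure X :=
  ν.withDensity (fun y => ENNReal.ofReal (Real.sigmoid (score (gp y) c)))

/-- The positive term `I_α` for the anchor `x` and its positive partner `x'`. The first part is the
contribution of the pair itself, the second one that of the other positives, that is,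
`p_x⁺` conditioned on not belonging to the pair. -/
def posTerm {X C : Type*} [MeasurableSpace X] {d : ℕ} (p : Measure X) (h : X → C)
    (f : X → EuclideanSpace ℝ (Fin d)) (α : ℝ) (x x' : X) : ℝ :=
  Real.exp (inner ℝ (f x) (f x')) +
    α * ∫ y, Real.exp (-inner ℝ (f x) (f y)) ∂(cond (posDist p h x) {x, x'}ᶜ)

/-- The negative term `II`: `Q · E_{y ∼ q_x} exp (γ ⟪f x, f y⟫)`. -/
def negTerm {X : Type*} [MeasurableSpace X] {d : ℕ} (f : X → EuclideanSpace ℝ (Fin d))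
    (Q γ : ℝ) (q : X → Measure X) (x : X) : ℝ :=
  Q * ∫ y, Real.exp (γ * inner ℝ (f x) (f y)) ∂(q x)

/-- The contrastive objective of Robinson et al. for a family `q` of negative distributions:
`E_{x ∼ p, x⁺ ∼ p_x⁺} [-log (e^{f(x)f(x⁺)} / (e^{f(x)f(x⁺)} + Q E_{x⁻ ∼ q_x} e^{f(x)f(x⁻)}))]`. -/
def contrastiveLoss {X C : Type*} [MeasurableSpace X] {d : ℕ} (p : Measure X) (h : X → C)
    (Q : ℝ) (f : X → EuclideanSpace ℝ (Fin d)) (q : X → Measure X) : ℝ :=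
  ∫ x, ∫ x', -Real.log (Real.exp (inner ℝ (f x) (f x')) /
      (Real.exp (inner ℝ (f x) (f x')) + Q * ∫ y, Real.exp (inner ℝ (f x) (f y)) ∂(q x)))
    ∂(posDist p h x) ∂p

/-- The unsupervised hard-negative objective of Robinson et al.: the negatives are drawn from
`q_β⁻(y) ∝ exp (β ⟪ḡ x, ḡ y⟫) p(y)` on `{y | h y ≠ h x}`. -/
def robinsonLoss {X C : Type*} [MeasurableSpace X] {d : ℕ} (p : Measure X) (h : X → C)
    (τ Q β : ℝ) (g : X → EuclideanSpace ℝ (Fin d)) : ℝ :=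
  contrastiveLoss p h Q (normalised τ g) (hardNeg (fun _ => p) h (normalised τ g) β)

/-- The SHARP objective `E_{x ∼ p, x⁺ ∼ p_x⁺} [-log (I_α / (I_α + II))]`, with negatives drawn
from `q_β⁻(y) ∝ exp (β ⟪ḡ x, ḡ y⟫) σ(g_p(y))` on `{y | h y ≠ h x}` and exponent `γ ⟪ḡ x, ḡ y⟫`
in the negative term. -/
def sharpLoss {X Z C : Type*} [MeasurableSpace X] {d : ℕ} (p ν : Measure X) (h : X → C)
    (gp : X → Z) (score : Z → C → ℝ) (τ Q γ α β : ℝ) (g : X → EuclideanSpace ℝ (Fin d)) : ℝ :=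
  ∫ x, ∫ x', -Real.log (posTerm p h (normalised τ g) α x x' /
      (posTerm p h (normalised τ g) α x x' +
        negTerm (normalised τ g) Q γ
          (hardNeg (classifierBase ν gp score) h (normalised τ g) β) x))
    ∂(posDist p h x) ∂p

/-- The worst-case SHARP objective `sup_β L(g, 0, β)`. -/
def sharpWorst {X Z C : Type*} [MeasurableSpace X] {d : ℕ} (p ν : Measure X) (h : X → C)
    (gp : X → Z) (score : Z → C → ℝ) (τ Q : ℝ) (g : X → EuclideanSpace ℝ (Fin d)) : ℝ :=
  ⨆ β : Set.Ioi (0 : ℝ), sharpLoss p ν h gp score τ Q 1 0 β g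

/-- The worst-case unsupervised objective: the supremum over `β` of the objective of
Robinson et al. -/
def robinsonWorst {X C : Type*} [MeasurableSpace X] {d : ℕ} (p : Measure X) (h : X → C)
    (τ Q : ℝ) (g : X → EuclideanSpace ℝ (Fin d)) : ℝ :=
  ⨆ β : Set.Ioi (0 : ℝ), robinsonLoss p h τ Q β g

/-- The worst-case objective with decoupled denominator (the limit of many negatives):
`sup_β E_{x ∼ p, x⁺ ∼ p_x⁺} [-log (e^{ḡ(x)ḡ(x⁺)} / E_{x⁻ ∼ q_β⁻} e^{ḡ(x)ḡ(x⁻)})]`. -/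
def sharpWorstLimit {X Z C : Type*} [MeasurableSpace X] {d : ℕ} (p ν : Measure X) (h : X → C)
    (gp : X → Z) (score : Z → C → ℝ) (τ : ℝ) (g : X → EuclideanSpace ℝ (Fin d)) : ℝ :=
  ⨆ β : Set.Ioi (0 : ℝ), ∫ x, ∫ x',
      -Real.log (Real.exp (inner ℝ (normalised τ g x) (normalised τ g x')) /
        ∫ y, Real.exp (inner ℝ (normalised τ g x) (normalised τ g y))
          ∂(hardNeg (classifierBase ν gp score) h (normalised τ g) β x))
    ∂(posDist p h x) ∂p

/-- A configuration of one point per class on the sphere of radius `1/√τ`. -/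
def OnSphere {C : Type*} {d : ℕ} (τ : ℝ) (v : C → EuclideanSpace ℝ (Fin d)) : Prop :=
  ∀ c, ‖v c‖ = 1 / √τ

/-- The margin of the class `c`: the distance from `v c` to the nearest other point. -/
def classMargin {C : Type*} {d : ℕ} (v : C → EuclideanSpace ℝ (Fin d)) (c : C) : ℝ :=
  ⨅ c' : {c' : C // c' ≠ c}, ‖v c - v c'‖

/-- The smallest distance between the points of two different classes. -/
def margin {C : Type*} {d : ℕ} (v : C → EuclideanSpace ℝ (Fin d)) : ℝ :=
  ⨅ c, classMargin v c

/-- The cost of the packing problem for finite `Q`, a decreasing function of the class margins. -/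
def packingCost {X C : Type*} [MeasurableSpace X] [Fintype C] {d : ℕ} (p : Measure X) (h : X → C)
    (Q : ℝ) (v : C → EuclideanSpace ℝ (Fin d)) : ℝ :=
  ∑ c, p.real {x | h x = c} * Real.log (1 + Q * Real.exp (-(classMargin v c ^ 2) / 2))

/-- The cost of the limiting packing problem; to minimise it is to maximise
`∑ c, ρ(c) min_{c' ≠ c} ‖v c - v c'‖²`. -/
def packingCostLimit {X C : Type*} [MeasurableSpace X] [Fintype C] {d : ℕ} (p : Measure X)
    (h : X → C) (v : C → EuclideanSpace ℝ (Fin d)) : ℝ :=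
  -(∑ c, p.real {x | h x = c} * classMargin v c ^ 2) / 2

/-- `v` solves the packing problem with cost `K` up to `ε` (exactly, if `ε = 0`). -/
def IsPacking {C : Type*} {d : ℕ} (τ : ℝ) (K : (C → EuclideanSpace ℝ (Fin d)) → ℝ) (ε : ℝ)
    (v : C → EuclideanSpace ℝ (Fin d)) : Prop :=
  OnSphere τ v ∧ ∀ v', OnSphere τ v' → K v ≤ K v' + ε

/-- `g` minimises `F` over all embeddings up to `ε` (exactly, if `ε = 0`). -/
def IsMinimiser {X : Type*} [MeasurableSpace X] {d : ℕ}
    (F : (X → EuclideanSpace ℝ (Fin d)) → ℝ) (ε : ℝ) (g : X → EuclideanSpace ℝ (Fin d)) : Prop :=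
  IsEmbedding g ∧ ∀ g', IsEmbedding g' → F g ≤ F g' + ε

/-- `hhat` is a nearest-neighbour classifier for the embedding `f` and the class
representatives `v`; ties are broken arbitrarily. -/
def IsNearestNeighbour {X C : Type*} {d : ℕ} (f : X → EuclideanSpace ℝ (Fin d))
    (v : C → EuclideanSpace ℝ (Fin d)) (hhat : X → C) : Prop :=
  ∀ x c, ‖f x - v (hhat x)‖ ≤ ‖f x - v c‖

/-- The misclassification risk `P(ĥ(x) ≠ h(x))`. -/
def risk {X C : Type*} [MeasurableSpace X] (p : Measure X) (h hhat : X → C) : ℝ :=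
  p.real {x | hhat x ≠ h x}

/-- `F` has a minimiser, and its minimisers are exactly the embeddings that almost surely send
each class to its point in an optimal packing for the cost `K`. -/
def MinimisersArePackings {X C : Type*} [MeasurableSpace X] {d : ℕ} (p : Measure X) (h : X → C)
    (τ : ℝ) (F : (X → EuclideanSpace ℝ (Fin d)) → ℝ) (K : (C → EuclideanSpace ℝ (Fin d)) → ℝ) :
    Prop :=
  (∃ g, IsMinimiser F 0 g) ∧
  ∀ g, IsEmbedding g →
    (IsMinimiser F 0 g ↔ ∃ v, IsPacking τ K 0 v ∧ ∀ᵐ x ∂p, normalised τ g x = v (h x))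

/-- Every embedding that minimises `F` up to `ε` admits class representatives which form an
`ε`-optimal packing `v` and whose nearest-neighbour classifiers have risk at most
`8 κ ε / (margin v)²`. -/
def RiskBound {X C : Type*} [MeasurableSpace X] {d : ℕ} (p : Measure X) (h : X → C)
    (τ : ℝ) (F : (X → EuclideanSpace ℝ (Fin d)) → ℝ) (K : (C → EuclideanSpace ℝ (Fin d)) → ℝ)
    (κ : ℝ) : Prop :=
  ∀ ε, 0 ≤ ε → ∀ g, IsMinimiser F ε g →
    ∃ v, IsPacking τ K ε v ∧
      ∀ hhat, IsNearestNeighbour (normalised τ g) v hhat →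
        risk p h hhat * margin v ^ 2 ≤ 8 * κ * ε

/-- If all optimal packings have margin larger than `ξ > 0`, then the risk of every embedding that
minimises `F` up to a small enough `ε` is at most `8 κ ε / ξ²`. -/
def UniformRiskBound {X C : Type*} [MeasurableSpace X] {d : ℕ} (p : Measure X) (h : X → C)
    (τ : ℝ) (F : (X → EuclideanSpace ℝ (Fin d)) → ℝ) (K : (C → EuclideanSpace ℝ (Fin d)) → ℝ)
    (κ : ℝ) : Prop :=
  ∀ ξ, 0 < ξ → (∀ v, IsPacking τ K 0 v → ξ < margin v) →
    ∃ ε₀, 0 < ε₀ ∧ ∀ ε, 0 ≤ ε → ε ≤ ε₀ → ∀ g, IsMinimiser F ε g →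
      ∃ v, IsPacking τ K ε v ∧
        ∀ hhat, IsNearestNeighbour (normalised τ g) v hhat →
          risk p h hhat ≤ 8 * κ * ε / ξ ^ 2

end SHARP

end

noncomputable section

namespace SHARP

set_option linter.unusedSectionVars false

section Tilting

variable {α : Type*} [MeasurableSpace α] {μ : Measure α} {u : α → ℝ} {B : ℝ}

theorem isBoundedUnder_le_of_abs_le (hB : ∀ y, |u y| ≤ B) :
    IsBoundedUnder (· ≤ ·) (ae μ) u :=
  isBoundedUnder_of ⟨B, fun y => (abs_le.1 (hB y)).2⟩

theorem isCoboundedUnder_le_of_abs_le [NeZero μ] (hB : ∀ y, |u y| ≤ B) :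
    IsCoboundedUnder (· ≤ ·) (ae μ) u :=
  IsBoundedUnder.isCoboundedUnder_le
    (isBoundedUnder_of ⟨-B, fun y => (abs_le.1 (hB y)).1⟩)

theorem measure_lt_ne_zero_of_lt_essSup [NeZero μ] (hB : ∀ y, |u y| ≤ B) {b : ℝ}
    (hb : b < essSup u μ) : μ {y | b < u y} ≠ 0 := by
  intro h0
  refine absurd hb (not_lt.2 (essSup_le_of_ae_le b ?_ (isCoboundedUnder_le_of_abs_le hB)))
  have : ∀ᵐ y ∂μ, ¬ b < u y := by simpa [ae_iff] using h0
  filter_upwards [this] with y hy using not_lt.1 hy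

theorem le_essSup_of_measure_lt_ne_zero (hB : ∀ y, |u y| ≤ B) {b : ℝ}
    (hb : μ {y | b < u y} ≠ 0) : b ≤ essSup u μ := by
  by_contra hlt
  refine hb (measure_mono_null (fun y hy => ?_)
    (meas_essSup_lt (μ := μ) (f := u) (isBoundedUnder_le_of_abs_le hB)))
  exact (not_le.1 hlt).trans hy

theorem abs_essSup_le [NeZero μ] (hB : ∀ y, |u y| ≤ B) : |essSup u μ| ≤ B := by
  refine abs_le.2 ⟨?_, essSup_le_of_ae_le B (ae_of_all _ fun y => (abs_le.1 (hB y)).2)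
    (isCoboundedUnder_le_of_abs_le hB)⟩
  have h1 : ∀ᵐ y ∂μ, u y ≤ essSup u μ := ae_le_essSup (isBoundedUnder_le_of_abs_le hB)
  obtain ⟨y, hy⟩ := h1.exists
  exact (abs_le.1 (hB y)).1.trans hy

theorem integrable_exp_mul_of_abs_le [IsFiniteMeasure μ] (hu : Measurable u)
    (hB : ∀ y, |u y| ≤ B) (β : ℝ) : Integrable (fun y => Real.exp (β * u y)) μ := by
  refine Integrable.of_bound (C := Real.exp (|β| * B))
    (Real.measurable_exp.comp (hu.const_mul β)).aestronglyMeasurable (ae_of_all _ fun y => ?_)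
  rw [Real.norm_eq_abs, Real.abs_exp, Real.exp_le_exp]
  calc β * u y ≤ |β * u y| := le_abs_self _
    _ = |β| * |u y| := abs_mul _ _
    _ ≤ |β| * B := mul_le_mul_of_nonneg_left (hB y) (abs_nonneg _)

theorem integral_exp_mul_tilted (γ β : ℝ) :
    ∫ y, Real.exp (γ * u y) ∂(μ.tilted fun y => β * u y) =
      (∫ y, Real.exp ((β + γ) * u y) ∂μ) / ∫ y, Real.exp (β * u y) ∂μ := by
  rw [integral_exp_tilted]
  congr 1
  refine integral_congr_ae (ae_of_all _ fun y => ?_)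
  simp [add_mul]

theorem integral_exp_tilted_eq_div (β : ℝ) :
    ∫ y, Real.exp (u y) ∂(μ.tilted fun y => β * u y) =
      (∫ y, Real.exp ((β + 1) * u y) ∂μ) / ∫ y, Real.exp (β * u y) ∂μ := by
  simpa using integral_exp_mul_tilted (μ := μ) (u := u) 1 β

variable [IsFiniteMeasure μ] [NeZero μ]

theorem integral_exp_tilted_le (hu : Measurable u) (hB : ∀ y, |u y| ≤ B) (β : ℝ) :
    ∫ y, Real.exp (u y) ∂(μ.tilted fun y => β * u y) ≤ Real.exp (essSup u μ) := by
  have := isProbabilityMeasure_tilted (integrable_exp_mul_of_abs_le (μ := μ) hu hB β)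
  have h1 : ∀ᵐ y ∂(μ.tilted fun y => β * u y), u y ≤ essSup u μ :=
    (tilted_absolutelyContinuous μ _).ae_le (ae_le_essSup (isBoundedUnder_le_of_abs_le hB))
  calc ∫ y, Real.exp (u y) ∂(μ.tilted fun y => β * u y)
      ≤ ∫ _, Real.exp (essSup u μ) ∂(μ.tilted fun y => β * u y) := by
        refine integral_mono_ae ?_ (integrable_const _) ?_
        · simpa using integrable_exp_mul_of_abs_le
            (μ := μ.tilted fun y => β * u y) hu hB 1
        · filter_upwards [h1] with y hy using Real.exp_le_exp.2 hy
    _ = Real.exp (essSup u μ) := by simp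

theorem exp_neg_le_integral_exp_tilted (hu : Measurable u) (hB : ∀ y, |u y| ≤ B) (β : ℝ) :
    Real.exp (-B) ≤ ∫ y, Real.exp (u y) ∂(μ.tilted fun y => β * u y) := by
  have := isProbabilityMeasure_tilted (integrable_exp_mul_of_abs_le (μ := μ) hu hB β)
  calc Real.exp (-B) = ∫ _, Real.exp (-B) ∂(μ.tilted fun y => β * u y) := by simp
    _ ≤ _ := by
        refine integral_mono_ae (integrable_const _) ?_
          (ae_of_all _ fun y => Real.exp_le_exp.2 (abs_le.1 (hB y)).1)
        simpa using integrable_exp_mul_of_abs_le (μ := μ.tilted fun y => β * u y) hu hB 1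

theorem integral_exp_tilted_ge (hu : Measurable u) (hB : ∀ y, |u y| ≤ B) {a b β : ℝ}
    (hβ : 0 ≤ β) (hb : b < essSup u μ) :
    Real.exp a - Real.exp a * (μ.real Set.univ / μ.real {y | b < u y}) *
        Real.exp (-(β * (b - a))) ≤
      ∫ y, Real.exp (u y) ∂(μ.tilted fun y => β * u y) := by
  have hI := fun β => integrable_exp_mul_of_abs_le (μ := μ) hu hB β
  have hm : 0 < μ.real {y | b < u y} :=
    (measureReal_ne_zero_iff (measure_ne_top _ _)).2
      (measure_lt_ne_zero_of_lt_essSup hB hb) |>.symm.lt_of_le measureReal_nonneg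
  set Z := ∫ y, Real.exp (β * u y) ∂μ with hZ
  have hms : MeasurableSet {y | b < u y} := measurableSet_lt measurable_const hu
  have hZb : Real.exp (β * b) * μ.real {y | b < u y} ≤ Z := by
    calc Real.exp (β * b) * μ.real {y | b < u y}
        = ∫ _ in {y | b < u y}, Real.exp (β * b) ∂μ := by simp [mul_comm]
      _ ≤ ∫ y in {y | b < u y}, Real.exp (β * u y) ∂μ := by
          refine setIntegral_mono_on (integrable_const _).integrableOn (hI β).integrableOn hms ?_
          intro y hy
          exact Real.exp_le_exp.2 (mul_le_mul_of_nonneg_left (le_of_lt hy) hβ)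
      _ ≤ Z := setIntegral_le_integral (hI β) (ae_of_all _ fun y => (Real.exp_pos _).le)
  have hZ0 : 0 < Z := lt_of_lt_of_le (by positivity) hZb
  have hdiff : -(Real.exp a * Real.exp (β * a) * μ.real Set.univ) ≤
      (∫ y, Real.exp ((β + 1) * u y) ∂μ) - Real.exp a * Z := by
    rw [hZ, ← integral_const_mul, ← integral_sub (hI (β + 1)) ((hI β).const_mul _)]
    calc -(Real.exp a * Real.exp (β * a) * μ.real Set.univ)
        = ∫ _, -(Real.exp a * Real.exp (β * a)) ∂μ := by simp [mul_comm]
      _ ≤ _ := by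
          refine integral_mono (integrable_const _) ((hI (β + 1)).sub ((hI β).const_mul _)) ?_
          intro y
          simp only [add_mul, one_mul, Real.exp_add]
          rcases le_total a (u y) with hay | hay
          · have h1 := Real.exp_le_exp.2 hay
            have h2 := Real.exp_pos (β * u y)
            have h3 : 0 < Real.exp a * Real.exp (β * a) := by positivity
            nlinarith [mul_nonneg h2.le (sub_nonneg.2 h1)]
          · have h1 := Real.exp_le_exp.2 (mul_le_mul_of_nonneg_left hay hβ)
            have h2 : 0 < Real.exp (β * u y) * Real.exp (u y) := by positivity
            nlinarith [mul_nonneg (Real.exp_pos a).le (sub_nonneg.2 h1)]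
  rw [integral_exp_tilted_eq_div, ← hZ, le_div_iff₀ hZ0]
  have hexp : Real.exp (-(β * (b - a))) * Real.exp (β * b) = Real.exp (β * a) := by
    rw [← Real.exp_add]; ring_nf
  have hkey : Real.exp a * Real.exp (β * a) * μ.real Set.univ ≤
      Real.exp a * (μ.real Set.univ / μ.real {y | b < u y}) *
        Real.exp (-(β * (b - a))) * Z := by
    calc Real.exp a * Real.exp (β * a) * μ.real Set.univ
        = Real.exp a * (μ.real Set.univ / μ.real {y | b < u y}) *
          Real.exp (-(β * (b - a))) * (Real.exp (β * b) * μ.real {y | b < u y}) := by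
          rw [← hexp]; field_simp
      _ ≤ _ := mul_le_mul_of_nonneg_left hZb (by positivity)
  nlinarith

/-- Exponential tilting concentrates on the essential maximum of the tilting function. -/
theorem tendsto_integral_exp_tilted (hu : Measurable u) (hB : ∀ y, |u y| ≤ B) :
    Tendsto (fun β : ℝ => ∫ y, Real.exp (u y) ∂(μ.tilted fun y => β * u y)) atTop
      (𝓝 (Real.exp (essSup u μ))) := by
  refine tendsto_order.2 ⟨fun y hy => ?_, fun y hy => Eventually.of_forall fun β =>
    (integral_exp_tilted_le hu hB β).trans_lt hy⟩
  have hev : ∀ᶠ a in 𝓝[<] (essSup u μ), y < Real.exp a :=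
    nhdsWithin_le_nhds (Real.continuous_exp.continuousAt.eventually (lt_mem_nhds hy))
  obtain ⟨a, hya, ha⟩ := (hev.and self_mem_nhdsWithin).exists
  obtain ⟨b, hab, hb⟩ := exists_between ha
  have hlim : Tendsto (fun β : ℝ => Real.exp a - Real.exp a *
      (μ.real Set.univ / μ.real {y | b < u y}) * Real.exp (-(β * (b - a)))) atTop
      (𝓝 (Real.exp a - Real.exp a * (μ.real Set.univ / μ.real {y | b < u y}) * 0)) := by
    refine tendsto_const_nhds.sub (tendsto_const_nhds.mul ?_)
    exact Real.tendsto_exp_neg_atTop_nhds_zero.comp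
      (tendsto_id.atTop_mul_const (sub_pos.2 hab))
  filter_upwards [hlim.eventually (lt_mem_nhds (by simpa using hya)), eventually_ge_atTop 0]
    with β h1 h2
  exact h1.trans_le (integral_exp_tilted_ge hu hB h2 hb)

end Tilting

theorem tilted_smul_measure {α : Type*} [MeasurableSpace α] (μ : Measure α) (u : α → ℝ)
    {k : ENNReal} (h0 : k ≠ 0) (htop : k ≠ ⊤) : (k • μ).tilted u = μ.tilted u := by
  have hk : 0 < k.toReal := ENNReal.toReal_pos h0 htop
  rw [Measure.tilted, Measure.tilted, withDensity_smul_measure, integral_smul_measure,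
    ← withDensity_smul' _ _ htop]
  congr 1
  ext y
  rw [Pi.smul_apply, smul_eq_mul, smul_eq_mul]
  nth_rewrite 1 [← ENNReal.ofReal_toReal htop]
  rw [← ENNReal.ofReal_mul hk.le]
  congr 1
  rw [← mul_div_assoc, mul_div_mul_left _ _ hk.ne']

/-- The largest similarity of the anchor `x` with a negative, up to null sets. -/
def hardest {X C : Type*} [MeasurableSpace X] {d : ℕ} (p : Measure X) (h : X → C)
    (f : X → EuclideanSpace ℝ (Fin d)) (x : X) : ℝ :=
  essSup (fun y => inner ℝ (f x) (f y)) (p.restrict {y | h y ≠ h x})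

/-- The logarithm of the average exponential similarity of `x` with its negatives. -/
def logNeg {X : Type*} [MeasurableSpace X] {d : ℕ} (f : X → EuclideanSpace ℝ (Fin d))
    (q : X → Measure X) (x : X) : ℝ :=
  Real.log (∫ y, Real.exp (inner ℝ (f x) (f y)) ∂(q x))

/-- The expectation over positive pairs of `φ` at the gap between the score `m x` of the negatives
and the similarity of the pair. -/
def pairLoss {X C : Type*} [MeasurableSpace X] {d : ℕ} (φ : ℝ → ℝ) (p : Measure X) (h : X → C)
    (f : X → EuclideanSpace ℝ (Fin d)) (m : X → ℝ) : ℝ :=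
  ∫ x, ∫ x', φ (m x - inner ℝ (f x) (f x')) ∂(posDist p h x) ∂p

section Classes

variable {X C : Type*} [MeasurableSpace X] {h : X → C}

theorem isProbabilityMeasure_posDist (p : Measure X) [IsProbabilityMeasure p]
    (hclass : ∀ c, p {x | h x = c} ≠ 0) (x : X) : IsProbabilityMeasure (posDist p h x) :=
  cond_isProbabilityMeasure (hclass _)

theorem neZero_restrict_ne_class [Nontrivial C] {p : Measure X}
    (hclass : ∀ c, p {x | h x = c} ≠ 0) {μ : Measure X} (hpμ : p ≪ μ) (c : C) :
    NeZero (μ.restrict {y | h y ≠ c}) := by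
  refine ⟨fun h0 => ?_⟩
  obtain ⟨c', hc'⟩ := exists_ne c
  rw [Measure.restrict_eq_zero] at h0
  refine hclass c' (measure_mono_null ?_ (hpμ h0))
  rintro y rfl
  exact hc'

variable [Fintype C] [MeasurableSpace C] [MeasurableSingletonClass C]

theorem measurableSet_class (hh : Measurable h) (c : C) : MeasurableSet {y | h y = c} :=
  hh (measurableSet_singleton c)

theorem measurableSet_ne_class (hh : Measurable h) (c : C) : MeasurableSet {y | h y ≠ c} :=
  (measurableSet_class hh c).compl

theorem measurable_comp_class (hh : Measurable h) {G : C → X → ℝ} (hG : ∀ c, Measurable (G c)) :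
    Measurable fun x => G (h x) x := by
  have : Measurable (fun z : C × X => G z.1 z.2) := measurable_from_prod_countable_right hG
  exact this.comp (hh.prodMk measurable_id)

theorem integral_eq_sum_cond (hh : Measurable h) {p : Measure X} [IsProbabilityMeasure p]
    {F : X → ℝ} (hF : Integrable F p) :
    ∫ x, F x ∂p = ∑ c, p.real {x | h x = c} * ∫ x, F x ∂(cond p {y | h y = c}) := by
  have hint : ∀ c ∈ (Finset.univ : Finset C),
      Integrable F (p (h ⁻¹' {c}) • cond p (h ⁻¹' {c})) := by
    intro c _
    refine Integrable.mono_measure hF ?_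
    conv_rhs => rw [← sum_meas_smul_cond_fiber hh p]
    exact Finset.single_le_sum (f := fun c => p (h ⁻¹' {c}) • cond p (h ⁻¹' {c}))
      (fun _ _ => Measure.zero_le _) (Finset.mem_univ c)
  conv_lhs => rw [← sum_meas_smul_cond_fiber hh p]
  rw [integral_finsetSum_measure hint]
  refine Finset.sum_congr rfl fun c _ => ?_
  rw [integral_smul_measure]
  rfl

end Classes

section PairLoss

variable {X C : Type*} [MeasurableSpace X] [Fintype C] [MeasurableSpace C]
  [MeasurableSingletonClass C] {d : ℕ} {p : Measure X} [IsProbabilityMeasure p] {h : X → C}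
  {f : X → EuclideanSpace ℝ (Fin d)} {R : ℝ} {φ : ℝ → ℝ} {m : X → ℝ}

theorem abs_comp_gap_le (hφ : Monotone φ) (hR : ∀ x y, |inner ℝ (f x) (f y)| ≤ R) {x : X} {t : ℝ}
    (ht : |t| ≤ R) (x' : X) :
    |φ (t - inner ℝ (f x) (f x'))| ≤ |φ (-(2 * R))| + |φ (2 * R)| := by
  have h1 := abs_le.1 (hR x x')
  have h2 := abs_le.1 ht
  have h3 : φ (-(2 * R)) ≤ φ (t - inner ℝ (f x) (f x')) := hφ (by linarith)
  have h4 : φ (t - inner ℝ (f x) (f x')) ≤ φ (2 * R) := hφ (by linarith)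
  rw [abs_le]
  constructor
  · linarith [neg_abs_le (φ (-(2 * R))), abs_nonneg (φ (2 * R))]
  · linarith [le_abs_self (φ (2 * R)), abs_nonneg (φ (-(2 * R)))]

theorem measurable_gap (hφc : Continuous φ) (hf : Measurable f) (t : ℝ) (x : X) :
    Measurable fun x' => φ (t - inner ℝ (f x) (f x')) := by
  refine hφc.measurable.comp (measurable_const.sub ?_)
  exact measurable_const.inner hf

theorem integrable_gap (hφ : Monotone φ) (hφc : Continuous φ) (hf : Measurable f)
    (hR : ∀ x y, |inner ℝ (f x) (f y)| ≤ R) {x : X} {t : ℝ} (ht : |t| ≤ R)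
    (μ : Measure X) [IsFiniteMeasure μ] :
    Integrable (fun x' => φ (t - inner ℝ (f x) (f x'))) μ :=
  Integrable.of_bound (measurable_gap hφc hf t x).aestronglyMeasurable _
    (ae_of_all _ fun x' => by
      rw [Real.norm_eq_abs]; exact abs_comp_gap_le hφ hR ht x')

theorem measurable_integral_gap_cond (hφc : Continuous φ) (hf : Measurable f)
    (hm : Measurable m) (μ : Measure X) [IsFiniteMeasure μ] :
    Measurable fun x => ∫ x', φ (m x - inner ℝ (f x) (f x')) ∂μ := by
  refine (StronglyMeasurable.integral_prod_right (f := fun x x' =>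
    φ (m x - inner ℝ (f x) (f x'))) ?_).measurable
  refine Measurable.stronglyMeasurable ?_
  refine hφc.measurable.comp ((hm.comp measurable_fst).sub ?_)
  exact (hf.comp measurable_fst).inner (hf.comp measurable_snd)

theorem measurable_integral_gap (hh : Measurable h) (hφc : Continuous φ) (hf : Measurable f)
    (hm : Measurable m) :
    Measurable fun x => ∫ x', φ (m x - inner ℝ (f x) (f x')) ∂(posDist p h x) :=
  measurable_comp_class hh (G := fun c x =>
    ∫ x', φ (m x - inner ℝ (f x) (f x')) ∂(cond p {y | h y = c}))
    fun _ => measurable_integral_gap_cond hφc hf hm _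

variable (hclass : ∀ c, p {x | h x = c} ≠ 0)
include hclass

theorem abs_integral_gap_le (hφ : Monotone φ) (hR : ∀ x y, |inner ℝ (f x) (f y)| ≤ R)
    {x : X} {t : ℝ} (ht : |t| ≤ R) :
    |∫ x', φ (t - inner ℝ (f x) (f x')) ∂(posDist p h x)| ≤
      |φ (-(2 * R))| + |φ (2 * R)| := by
  have := isProbabilityMeasure_posDist p hclass x
  have := norm_integral_le_of_norm_le_const (μ := posDist p h x)
    (ae_of_all _ fun x' => (Real.norm_eq_abs _).trans_le (abs_comp_gap_le (x := x) hφ hR ht x'))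
  simpa using this

theorem integrable_integral_gap (hh : Measurable h) (hφ : Monotone φ) (hφc : Continuous φ)
    (hf : Measurable f) (hR : ∀ x y, |inner ℝ (f x) (f y)| ≤ R) (hm : Measurable m)
    (hmR : ∀ x, |m x| ≤ R) :
    Integrable (fun x => ∫ x', φ (m x - inner ℝ (f x) (f x')) ∂(posDist p h x)) p :=
  Integrable.of_bound (measurable_integral_gap hh hφc hf hm).aestronglyMeasurable _
    (ae_of_all _ fun x => by
      rw [Real.norm_eq_abs]; exact abs_integral_gap_le hclass hφ hR (hmR x))

theorem pairLoss_mono (hh : Measurable h) (hφ : Monotone φ) (hφc : Continuous φ)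
    (hf : Measurable f) (hR : ∀ x y, |inner ℝ (f x) (f y)| ≤ R) {m' : X → ℝ} (hm : Measurable m)
    (hmR : ∀ x, |m x| ≤ R) (hm' : Measurable m') (hmR' : ∀ x, |m' x| ≤ R)
    (hle : ∀ x, m x ≤ m' x) : pairLoss φ p h f m ≤ pairLoss φ p h f m' := by
  refine integral_mono (integrable_integral_gap hclass hh hφ hφc hf hR hm hmR)
    (integrable_integral_gap hclass hh hφ hφc hf hR hm' hmR') fun x => ?_
  have := isProbabilityMeasure_posDist p hclass x
  exact integral_mono (integrable_gap hφ hφc hf hR (hmR x) _)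
    (integrable_gap hφ hφc hf hR (hmR' x) _) fun x' => hφ (by linarith [hle x])

theorem tendsto_pairLoss (hh : Measurable h) (hφ : Monotone φ) (hφc : Continuous φ)
    (hf : Measurable f) (hR : ∀ x y, |inner ℝ (f x) (f y)| ≤ R) {mb : ℝ → X → ℝ}
    (hm : ∀ b, Measurable (mb b)) (hmR : ∀ b x, |mb b x| ≤ R)
    (hlim : ∀ x, Tendsto (fun b => mb b x) atTop (𝓝 (m x))) :
    Tendsto (fun b => pairLoss φ p h f (mb b)) atTop (𝓝 (pairLoss φ p h f m)) := by
  refine tendsto_integral_filter_of_dominated_convergence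
    (fun _ => |φ (-(2 * R))| + |φ (2 * R)|)
    (Eventually.of_forall fun b => (measurable_integral_gap hh hφc hf (hm b)).aestronglyMeasurable)
    (Eventually.of_forall fun b => ae_of_all _ fun x => ?_) (integrable_const _)
    (ae_of_all _ fun x => ?_)
  · rw [Real.norm_eq_abs]
    exact abs_integral_gap_le hclass hφ hR (hmR b x)
  · have := isProbabilityMeasure_posDist p hclass x
    refine tendsto_integral_filter_of_dominated_convergence
      (fun _ => |φ (-(2 * R))| + |φ (2 * R)|)
      (Eventually.of_forall fun b => (measurable_gap hφc hf _ x).aestronglyMeasurable)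
      (Eventually.of_forall fun b => ae_of_all _ fun x' => ?_) (integrable_const _)
      (ae_of_all _ fun x' => ?_)
    · rw [Real.norm_eq_abs]
      exact abs_comp_gap_le hφ hR (hmR b x) x'
    · exact (hφc.tendsto _).comp ((hlim x).sub tendsto_const_nhds)

end PairLoss

section HardNegatives

variable {X C : Type*} [MeasurableSpace X] [Fintype C] [Nontrivial C] [MeasurableSpace C]
  [MeasurableSingletonClass C] {d : ℕ} {p : Measure X} [IsProbabilityMeasure p] {h : X → C}
  {f : X → EuclideanSpace ℝ (Fin d)} {R : ℝ} {base : C → Measure X}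
  [∀ c, IsFiniteMeasure (base c)]

theorem hardest_eq_essSup_base (hpb : ∀ c, p ≪ base c) (hbp : ∀ c, base c ≪ p) (x : X) :
    hardest p h f x =
      essSup (fun y => inner ℝ (f x) (f y)) ((base (h x)).restrict {y | h y ≠ h x}) := by
  have : ae (p.restrict {y | h y ≠ h x}) = ae ((base (h x)).restrict {y | h y ≠ h x}) :=
    le_antisymm ((hpb (h x)).restrict _).ae_le ((hbp (h x)).restrict _).ae_le
  rw [hardest, essSup, essSup, this]

theorem measurable_integral_exp_hardNeg (hh : Measurable h) (hf : Measurable f) (γ β : ℝ) :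
    Measurable fun x => ∫ y, Real.exp (γ * inner ℝ (f x) (f y)) ∂(hardNeg base h f β x) := by
  have hmeas : ∀ (c : C) (b : ℝ), Measurable fun x =>
      ∫ y, Real.exp (b * inner ℝ (f x) (f y)) ∂((base c).restrict {y | h y ≠ c}) := by
    intro c b
    refine (StronglyMeasurable.integral_prod_right (f := fun x y =>
      Real.exp (b * inner ℝ (f x) (f y))) ?_).measurable
    refine Measurable.stronglyMeasurable (Real.measurable_exp.comp (Measurable.const_mul ?_ b))
    exact (hf.comp measurable_fst).inner (hf.comp measurable_snd)
  refine measurable_comp_class hh (G := fun c x => ∫ y, Real.exp (γ * inner ℝ (f x) (f y))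
    ∂(((base c).restrict {y | h y ≠ c}).tilted fun y => β * inner ℝ (f x) (f y))) fun c => ?_
  simp_rw [integral_exp_mul_tilted]
  exact (hmeas c _).div (hmeas c _)

theorem measurable_logNeg (hh : Measurable h) (hf : Measurable f) (β : ℝ) :
    Measurable (logNeg f (hardNeg base h f β)) := by
  have := measurable_integral_exp_hardNeg (base := base) hh hf 1 β
  simp only [one_mul] at this
  exact Real.measurable_log.comp this

theorem abs_hardest_le (hclass : ∀ c, p {x | h x = c} ≠ 0)
    (hR : ∀ x y, |inner ℝ (f x) (f y)| ≤ R) (x : X) : |hardest p h f x| ≤ R :=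
  have := neZero_restrict_ne_class hclass Measure.AbsolutelyContinuous.rfl (h x)
  abs_essSup_le (hR x)

variable (hclass : ∀ c, p {x | h x = c} ≠ 0) (hpb : ∀ c, p ≪ base c)
include hclass hpb

theorem integral_exp_hardNeg_pos (hf : Measurable f) (hR : ∀ x y, |inner ℝ (f x) (f y)| ≤ R)
    (β : ℝ) (x : X) : 0 < ∫ y, Real.exp (inner ℝ (f x) (f y)) ∂(hardNeg base h f β x) :=
  have := neZero_restrict_ne_class hclass (hpb (h x)) (h x)
  (Real.exp_pos _).trans_le
    (exp_neg_le_integral_exp_tilted (measurable_const.inner hf) (hR x) β)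

variable (hbp : ∀ c, base c ≪ p)
include hbp

theorem logNeg_le_hardest (hf : Measurable f) (hR : ∀ x y, |inner ℝ (f x) (f y)| ≤ R)
    (β : ℝ) (x : X) : logNeg f (hardNeg base h f β) x ≤ hardest p h f x := by
  have := neZero_restrict_ne_class hclass (hpb (h x)) (h x)
  rw [hardest_eq_essSup_base hpb hbp, logNeg,
    Real.log_le_iff_le_exp (integral_exp_hardNeg_pos hclass hpb hf hR β x)]
  exact integral_exp_tilted_le (measurable_const.inner hf) (hR x) β

theorem abs_logNeg_le (hf : Measurable f) (hR : ∀ x y, |inner ℝ (f x) (f y)| ≤ R)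
    (β : ℝ) (x : X) : |logNeg f (hardNeg base h f β) x| ≤ R := by
  have := neZero_restrict_ne_class hclass (hpb (h x)) (h x)
  refine abs_le.2 ⟨?_, (logNeg_le_hardest hclass hpb hbp hf hR β x).trans
    (abs_le.1 (abs_hardest_le hclass hR x)).2⟩
  rw [logNeg, Real.le_log_iff_exp_le (integral_exp_hardNeg_pos hclass hpb hf hR β x)]
  exact exp_neg_le_integral_exp_tilted (measurable_const.inner hf) (hR x) β

theorem tendsto_logNeg (hf : Measurable f) (hR : ∀ x y, |inner ℝ (f x) (f y)| ≤ R) (x : X) :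
    Tendsto (fun β => logNeg f (hardNeg base h f β) x) atTop (𝓝 (hardest p h f x)) := by
  have := neZero_restrict_ne_class hclass (hpb (h x)) (h x)
  rw [hardest_eq_essSup_base hpb hbp, ← Real.log_exp (essSup _ _)]
  exact (tendsto_integral_exp_tilted (measurable_const.inner hf) (hR x)).log
    (Real.exp_pos _).ne'

omit hpb hbp in
theorem measurable_hardest (hh : Measurable h) (hf : Measurable f)
    (hR : ∀ x y, |inner ℝ (f x) (f y)| ≤ R) : Measurable (hardest p h f) := by
  refine measurable_of_tendsto_metrizable' atTop
    (f := fun β : ℝ => logNeg f (hardNeg (fun _ => p) h f β))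
    (fun β => measurable_logNeg hh hf β) (tendsto_pi_nhds.2 fun x => ?_)
  exact tendsto_logNeg hclass (fun _ => Measure.AbsolutelyContinuous.rfl)
    (fun _ => Measure.AbsolutelyContinuous.rfl) hf hR x

theorem pairLoss_logNeg_le {φ : ℝ → ℝ} (hφ : Monotone φ) (hφc : Continuous φ)
    (hh : Measurable h) (hf : Measurable f) (hR : ∀ x y, |inner ℝ (f x) (f y)| ≤ R) (β : ℝ) :
    pairLoss φ p h f (logNeg f (hardNeg base h f β)) ≤ pairLoss φ p h f (hardest p h f) :=
  pairLoss_mono hclass hh hφ hφc hf hR (measurable_logNeg hh hf β)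
    (abs_logNeg_le hclass hpb hbp hf hR β) (measurable_hardest hclass hh hf hR)
    (abs_hardest_le hclass hR) (logNeg_le_hardest hclass hpb hbp hf hR β)

theorem tendsto_pairLoss_logNeg {φ : ℝ → ℝ} (hφ : Monotone φ) (hφc : Continuous φ)
    (hh : Measurable h) (hf : Measurable f) (hR : ∀ x y, |inner ℝ (f x) (f y)| ≤ R) :
    Tendsto (fun β => pairLoss φ p h f (logNeg f (hardNeg base h f β))) atTop
      (𝓝 (pairLoss φ p h f (hardest p h f))) :=
  tendsto_pairLoss hclass hh hφ hφc hf hR (fun β => measurable_logNeg hh hf β)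
    (abs_logNeg_le hclass hpb hbp hf hR) (tendsto_logNeg hclass hpb hbp hf hR)

/-- In the limit of hard negatives only the most similar negative counts, whatever the reference
measure from which the negatives are drawn. -/
theorem iSup_pairLoss_logNeg {φ : ℝ → ℝ} (hφ : Monotone φ) (hφc : Continuous φ)
    (hh : Measurable h) (hf : Measurable f) (hR : ∀ x y, |inner ℝ (f x) (f y)| ≤ R) :
    ⨆ β : Set.Ioi (0 : ℝ), pairLoss φ p h f (logNeg f (hardNeg base h f β)) =
      pairLoss φ p h f (hardest p h f) := by
  have hle := pairLoss_logNeg_le hclass hpb hbp hφ hφc hh hf hR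
  have : Nonempty (Set.Ioi (0 : ℝ)) := ⟨⟨1, Set.mem_Ioi.2 one_pos⟩⟩
  refine le_antisymm (ciSup_le fun β => hle β) ?_
  refine le_of_tendsto (tendsto_pairLoss_logNeg hclass hpb hbp hφ hφc hh hf hR) ?_
  filter_upwards [eventually_gt_atTop 0] with β hβ
  exact le_ciSup (f := fun β : Set.Ioi (0 : ℝ) =>
    pairLoss φ p h f (logNeg f (hardNeg base h f β))) ⟨_, Set.forall_mem_range.2 fun β => hle β⟩
    ⟨β, hβ⟩

end HardNegatives

section Sphere

variable {d : ℕ} {τ : ℝ}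

theorem norm_normalised {X : Type*} (hτ : 0 < τ) {g : X → EuclideanSpace ℝ (Fin d)}
    (hg : ∀ x, g x ≠ 0) (x : X) : ‖normalised τ g x‖ = 1 / √τ := by
  have h1 : 0 < √τ := Real.sqrt_pos.2 hτ
  have h2 : 0 < ‖g x‖ := norm_pos_iff.2 (hg x)
  rw [normalised, norm_smul, norm_inv, Real.norm_of_nonneg (by positivity)]
  field_simp

theorem measurable_normalised {X : Type*} [MeasurableSpace X]
    {g : X → EuclideanSpace ℝ (Fin d)} (hg : Measurable g) : Measurable (normalised τ g) :=
  ((hg.norm.const_mul _).inv).smul hg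

theorem inner_eq_of_norm_eq (hτ : 0 < τ) {a b : EuclideanSpace ℝ (Fin d)} (ha : ‖a‖ = 1 / √τ)
    (hb : ‖b‖ = 1 / √τ) : inner ℝ a b = 1 / τ - ‖a - b‖ ^ 2 / 2 := by
  have h1 := norm_sub_sq_real a b
  have h2 : (1 / √τ) ^ 2 = 1 / τ := by rw [div_pow, Real.sq_sqrt hτ.le, one_pow]
  rw [ha, hb, h2] at h1
  linarith

theorem abs_inner_le_of_norm_eq (hτ : 0 < τ) {a b : EuclideanSpace ℝ (Fin d)}
    (ha : ‖a‖ = 1 / √τ) (hb : ‖b‖ = 1 / √τ) : |inner ℝ a b| ≤ 1 / τ := by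
  have h2 : (1 / √τ) ^ 2 = 1 / τ := by rw [div_pow, Real.sq_sqrt hτ.le, one_pow]
  calc |inner ℝ a b| ≤ ‖a‖ * ‖b‖ := abs_real_inner_le_norm a b
    _ = 1 / τ := by rw [ha, hb, ← h2, sq]

theorem normalised_eq_self {X : Type*} (hτ : 0 < τ) {g : X → EuclideanSpace ℝ (Fin d)}
    (hg : ∀ x, ‖g x‖ = 1 / √τ) : normalised τ g = g := by
  have h1 : 0 < √τ := Real.sqrt_pos.2 hτ
  funext x
  rw [normalised, hg, mul_one_div_cancel h1.ne', inv_one, one_smul]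

variable {C : Type*}

theorem isCompact_onSphere (τ : ℝ) :
    IsCompact {v : C → EuclideanSpace ℝ (Fin d) | OnSphere τ v} := by
  have : {v : C → EuclideanSpace ℝ (Fin d) | OnSphere τ v} =
      Set.univ.pi fun _ => Metric.sphere 0 (1 / √τ) := by
    ext v; simp [OnSphere, Set.mem_pi]
  rw [this]
  exact isCompact_univ_pi fun _ => isCompact_sphere _ _

theorem exists_onSphere (hd : 0 < d) (τ : ℝ) :
    ∃ v : C → EuclideanSpace ℝ (Fin d), OnSphere τ v :=
  ⟨fun _ => EuclideanSpace.single ⟨0, hd⟩ (1 / √τ), fun c => by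
    rw [EuclideanSpace.single, PiLp.norm_single, Real.norm_of_nonneg (by positivity)]⟩

end Sphere

section Margins

variable {C : Type*} [Fintype C] [Nontrivial C] {d : ℕ} {v : C → EuclideanSpace ℝ (Fin d)}

instance nonempty_other_class (c : C) : Nonempty {c' : C // c' ≠ c} :=
  let ⟨c', hc'⟩ := exists_ne c
  ⟨⟨c', hc'⟩⟩

theorem classMargin_le {c c' : C} (hc : c' ≠ c) : classMargin v c ≤ ‖v c - v c'‖ :=
  ciInf_le (f := fun c' : {c' : C // c' ≠ c} => ‖v c - v c'‖) (Set.finite_range _).bddBelow ⟨c', hc⟩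

theorem exists_classMargin_eq (v : C → EuclideanSpace ℝ (Fin d)) (c : C) :
    ∃ c', c' ≠ c ∧ classMargin v c = ‖v c - v c'‖ := by
  obtain ⟨⟨c', hc'⟩, h⟩ := exists_eq_ciInf_of_finite (f := fun c' : {c' : C // c' ≠ c} =>
    ‖v c - v c'‖)
  exact ⟨c', hc', h.symm⟩

theorem classMargin_nonneg (v : C → EuclideanSpace ℝ (Fin d)) (c : C) : 0 ≤ classMargin v c :=
  le_ciInf fun _ => norm_nonneg _

theorem margin_nonneg (v : C → EuclideanSpace ℝ (Fin d)) : 0 ≤ margin v :=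
  le_ciInf fun c => classMargin_nonneg v c

theorem margin_le {c c' : C} (hc : c' ≠ c) : margin v ≤ ‖v c - v c'‖ :=
  (ciInf_le (Set.finite_range _).bddBelow c).trans (classMargin_le hc)

theorem continuous_ciInf_of_finite {ι Y : Type*} [Finite ι] [Nonempty ι] [TopologicalSpace Y]
    {F : ι → Y → ℝ} (hF : ∀ i, Continuous (F i)) : Continuous fun y => ⨅ i, F i y := by
  have := Fintype.ofFinite ι
  simp_rw [← Finset.inf'_univ_eq_ciInf]
  exact Continuous.finset_inf'_apply _ fun i _ => hF i

theorem continuous_classMargin (c : C) :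
    Continuous fun v : C → EuclideanSpace ℝ (Fin d) => classMargin v c :=
  continuous_ciInf_of_finite fun c' =>
    ((continuous_apply c).sub (continuous_apply (c' : C))).norm

theorem continuous_margin : Continuous fun v : C → EuclideanSpace ℝ (Fin d) => margin v :=
  continuous_ciInf_of_finite continuous_classMargin

theorem neg_half_sq_classMargin_ge {τ : ℝ} (hτ : 0 < τ) (hv : OnSphere τ v) (c : C) :
    -(2 / τ) ≤ -(classMargin v c ^ 2) / 2 := by
  obtain ⟨c', -, h⟩ := exists_classMargin_eq v c
  have h1 := inner_eq_of_norm_eq hτ (hv c) (hv c')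
  have h2 := (abs_le.1 (abs_inner_le_of_norm_eq hτ (hv c) (hv c'))).1
  rw [h]
  have : 2 / τ = 1 / τ + 1 / τ := by ring
  linarith

end Margins

section Cost

/-- The packing cost for a general increasing function `φ` of `-δ²/2`. -/
def gapCost {X C : Type*} [MeasurableSpace X] [Fintype C] {d : ℕ} (φ : ℝ → ℝ) (p : Measure X)
    (h : X → C) (v : C → EuclideanSpace ℝ (Fin d)) : ℝ :=
  ∑ c, p.real {x | h x = c} * φ (-(classMargin v c ^ 2) / 2)

variable {X C : Type*} [MeasurableSpace X] [Fintype C] [Nontrivial C] [MeasurableSpace C]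
  [MeasurableSingletonClass C] {d : ℕ} {τ : ℝ} {p : Measure X} [IsProbabilityMeasure p] {h : X → C}
  {f : X → EuclideanSpace ℝ (Fin d)} {φ : ℝ → ℝ} {v : C → EuclideanSpace ℝ (Fin d)}

theorem continuous_gapCost (hφc : Continuous φ) :
    Continuous fun v : C → EuclideanSpace ℝ (Fin d) => gapCost φ p h v :=
  continuous_finsetSum _ fun c _ => continuous_const.mul
    (hφc.comp (((continuous_classMargin c).pow 2).neg.div_const 2))

theorem inner_le_hardest_of_mem_support (hf : Measurable f) {R : ℝ}
    (hR : ∀ x y, |inner ℝ (f x) (f y)| ≤ R) {x : X} {c' : C} (hc' : c' ≠ h x)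
    {w : EuclideanSpace ℝ (Fin d)}
    (hw : w ∈ (Measure.map f (cond p {y | h y = c'})).support) :
    inner ℝ (f x) w ≤ hardest p h f x := by
  refine le_of_forall_sub_le fun δ hδ => ?_
  refine le_essSup_of_measure_lt_ne_zero (hR x) fun h0 => ?_
  have hopen : IsOpen {z | inner ℝ (f x) w - δ < inner ℝ (f x) z} :=
    isOpen_lt continuous_const (continuous_const.inner continuous_id)
  have hpos := (Measure.mem_support_iff_forall w).1 hw _
    (hopen.mem_nhds (show inner ℝ (f x) w - δ < inner ℝ (f x) w by linarith))
  rw [Measure.map_apply hf hopen.measurableSet] at hpos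
  refine hpos.ne' ?_
  have hac : cond p {y | h y = c'} ≪ p.restrict {y | h y ≠ h x} := by
    refine Measure.AbsolutelyContinuous.trans (Measure.smul_absolutelyContinuous) ?_
    refine Measure.absolutelyContinuous_of_le (Measure.restrict_mono_set _ ?_)
    rintro y rfl
    exact hc'
  exact hac h0

theorem integrable_sq_dist (hh : Measurable h) (hf : Measurable f)
    (hn : ∀ x, ‖f x‖ = 1 / √τ) (hv : OnSphere τ v) (μ : Measure X) [IsFiniteMeasure μ] :
    Integrable (fun x => ‖f x - v (h x)‖ ^ 2) μ := by
  refine Integrable.of_bound (C := (2 / √τ) ^ 2) ?_ (ae_of_all _ fun x => ?_)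
  · exact ((hf.sub ((measurable_of_finite v).comp hh)).norm.pow_const 2).aestronglyMeasurable
  · rw [Real.norm_of_nonneg (by positivity)]
    refine pow_le_pow_left₀ (norm_nonneg _) ?_ 2
    calc ‖f x - v (h x)‖ ≤ ‖f x‖ + ‖v (h x)‖ := norm_sub_le _ _
      _ = 2 / √τ := by rw [hn, hv]; ring

variable (hclass : ∀ c, p {x | h x = c} ≠ 0)
include hclass

theorem ae_cond_class (hh : Measurable h) (c : C) : ∀ᵐ x ∂(cond p {y | h y = c}), h x = c :=
  ae_cond_mem (measurableSet_class hh c)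

theorem pairLoss_eq_sum (hh : Measurable h) (hφ : Monotone φ) (hφc : Continuous φ)
    (hf : Measurable f) {R : ℝ} (hR : ∀ x y, |inner ℝ (f x) (f y)| ≤ R) :
    pairLoss φ p h f (hardest p h f) = ∑ c, p.real {x | h x = c} *
      ∫ x, ∫ x', φ (hardest p h f x - inner ℝ (f x) (f x')) ∂(cond p {y | h y = c})
        ∂(cond p {y | h y = c}) := by
  rw [pairLoss, integral_eq_sum_cond hh (integrable_integral_gap hclass hh hφ hφc hf hR
    (measurable_hardest hclass hh hf hR) (abs_hardest_le hclass hR))]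
  refine Finset.sum_congr rfl fun c _ => ?_
  congr 1
  refine integral_congr_ae ?_
  filter_upwards [ae_cond_class hclass hh c] with x hx
  rw [posDist, hx]

/-- The worst-case loss of `f` is bounded below by the packing cost of suitable representatives
of the classes, plus a multiple of the mean square distance to these. -/
theorem exists_gapCost_add_le_pairLoss (hτ : 0 < τ) (hh : Measurable h) (hφ : Monotone φ)
    (hφc : Continuous φ) {κ : ℝ}
    (hslope : ∀ t s, -(2 / τ) ≤ t → 0 ≤ s → φ t + s / κ ≤ φ (t + s))
    (hf : Measurable f) (hn : ∀ x, ‖f x‖ = 1 / √τ) :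
    ∃ v : C → EuclideanSpace ℝ (Fin d), OnSphere τ v ∧
      gapCost φ p h v + (∫ x, ‖f x - v (h x)‖ ^ 2 ∂p) / (2 * κ) ≤
        pairLoss φ p h f (hardest p h f) := by
  have hR : ∀ x y, |inner ℝ (f x) (f y)| ≤ 1 / τ := fun x y =>
    abs_inner_le_of_norm_eq hτ (hn x) (hn y)
  have hprob : ∀ c, IsProbabilityMeasure (cond p {y | h y = c}) := fun c =>
    cond_isProbabilityMeasure (hclass c)
  have hmh := measurable_hardest hclass hh hf hR
  have hbh := abs_hardest_le hclass hR
  have hex : ∀ c, ∃ x, h x = c ∧ f x ∈ (Measure.map f (cond p {y | h y = c})).support ∧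
      ∫ x', φ (hardest p h f x - inner ℝ (f x) (f x')) ∂(cond p {y | h y = c}) ≤
      ∫ x, ∫ x', φ (hardest p h f x - inner ℝ (f x) (f x')) ∂(cond p {y | h y = c})
        ∂(cond p {y | h y = c}) := by
    intro c
    have hint : Integrable (fun x => ∫ x', φ (hardest p h f x - inner ℝ (f x) (f x'))
        ∂(cond p {y | h y = c})) (cond p {y | h y = c}) := by
      refine Integrable.of_bound (C := |φ (-(2 * (1 / τ)))| + |φ (2 * (1 / τ))|)
        (measurable_integral_gap_cond hφc hf hmh _).aestronglyMeasurable
        (ae_of_all _ fun x => ?_)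
      have := norm_integral_le_of_norm_le_const (μ := cond p {y | h y = c})
        (ae_of_all _ fun x' => (Real.norm_eq_abs _).trans_le
          (abs_comp_gap_le (x := x) hφ hR (hbh x) x'))
      simpa using this
    have hsupp : ∀ᵐ x ∂(cond p {y | h y = c}),
        f x ∈ (Measure.map f (cond p {y | h y = c})).support :=
      ae_of_ae_map hf.aemeasurable Measure.support_mem_ae
    have hgood := (ae_cond_class hclass hh c).and hsupp
    obtain ⟨x, hx, hle⟩ := exists_notMem_null_le_integral hint (ae_iff.1 hgood)
    have hx' := not_not.1 hx
    exact ⟨x, hx'.1, hx'.2, hle⟩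
  choose a hac hasupp hale using hex
  refine ⟨fun c => f (a c), fun c => hn _, ?_⟩
  set v : C → EuclideanSpace ℝ (Fin d) := fun c => f (a c) with hv
  have hvs : OnSphere τ v := fun c => hn _
  have hsq : ∀ (μ : Measure X) [IsFiniteMeasure μ],
      Integrable (fun x => ‖f x - v (h x)‖ ^ 2) μ := fun μ _ =>
    integrable_sq_dist hh hf hn hvs μ
  rw [pairLoss_eq_sum hclass hh hφ hφc hf hR, integral_eq_sum_cond hh (hsq p), gapCost,
    Finset.sum_div, ← Finset.sum_add_distrib]
  refine Finset.sum_le_sum fun c _ => ?_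
  rw [mul_div_assoc, ← mul_add]
  refine mul_le_mul_of_nonneg_left (le_trans ?_ (hale c)) measureReal_nonneg
  calc φ (-(classMargin v c ^ 2) / 2) +
        (∫ x, ‖f x - v (h x)‖ ^ 2 ∂(cond p {y | h y = c})) / (2 * κ)
      = ∫ x, (φ (-(classMargin v c ^ 2) / 2) + ‖f x - v (h x)‖ ^ 2 / (2 * κ))
          ∂(cond p {y | h y = c}) := by
        rw [integral_add (integrable_const _) ((hsq _).div_const _), integral_div]
        simp
    _ ≤ _ := by
        refine integral_mono_ae ((integrable_const _).add ((hsq _).div_const _))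
          (integrable_gap hφ hφc hf hR (hbh (a c)) _) ?_
        filter_upwards [ae_cond_class hclass hh c] with x hx
        obtain ⟨c', hc', hcm⟩ := exists_classMargin_eq v c
        have h1 : inner ℝ (v c) (v c') ≤ hardest p h f (a c) :=
          inner_le_hardest_of_mem_support hf hR (by rw [hac]; exact hc') (hasupp c')
        have h2 := inner_eq_of_norm_eq hτ (hvs c) (hvs c')
        have h3 := inner_eq_of_norm_eq hτ (hvs c) (hn x)
        have h4 := hslope _ (‖f x - v c‖ ^ 2 / 2) (neg_half_sq_classMargin_ge hτ hvs c)
          (by positivity)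
        rw [hx, ← div_div]
        refine h4.trans (hφ ?_)
        rw [norm_sub_rev] at h3
        rw [hcm]
        change _ ≤ hardest p h f (a c) - inner ℝ (v c) (f x)
        linarith

/-- An embedding that collapses each class to a point has the packing cost of these points as
its worst-case loss. -/
theorem pairLoss_eq_gapCost (hτ : 0 < τ) (hh : Measurable h)
    (hn : ∀ x, ‖f x‖ = 1 / √τ) (hv : OnSphere τ v) (hfv : ∀ᵐ x ∂p, f x = v (h x)) :
    pairLoss φ p h f (hardest p h f) = gapCost φ p h v := by
  have hR : ∀ x y, |inner ℝ (f x) (f y)| ≤ 1 / τ := fun x y =>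
    abs_inner_le_of_norm_eq hτ (hn x) (hn y)
  have hprob : ∀ c, IsProbabilityMeasure (cond p {y | h y = c}) := fun c =>
    cond_isProbabilityMeasure (hclass c)
  have hhard : ∀ᵐ x ∂p, hardest p h f x = 1 / τ - classMargin v (h x) ^ 2 / 2 := by
    filter_upwards [hfv] with x hx
    have := neZero_restrict_ne_class hclass Measure.AbsolutelyContinuous.rfl (h x)
    apply le_antisymm
    · refine essSup_le_of_ae_le _ ?_ (isCoboundedUnder_le_of_abs_le (hR x))
      filter_upwards [ae_restrict_of_ae hfv, ae_restrict_mem (measurableSet_ne_class hh (h x))]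
        with y hy hne
      rw [hx, hy, inner_eq_of_norm_eq hτ (hv _) (hv _)]
      have := classMargin_le (v := v) (c := h x) (c' := h y) hne
      have := pow_le_pow_left₀ (classMargin_nonneg v (h x)) this 2
      linarith
    · obtain ⟨c', hc', hcm⟩ := exists_classMargin_eq v (h x)
      have h1 : ∀ᵐ y ∂(p.restrict {y | h y ≠ h x}), inner ℝ (f x) (f y) ≤ hardest p h f x :=
        ae_le_essSup (isBoundedUnder_le_of_abs_le (hR x))
      have h2 : ∀ᵐ y ∂(cond p {y | h y = c'}),
          y ∈ {y | h y ≠ h x} → inner ℝ (f x) (f y) ≤ hardest p h f x :=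
        cond_absolutelyContinuous.ae_le
          ((ae_restrict_iff' (measurableSet_ne_class hh (h x))).1 h1)
      obtain ⟨y, hy1, hy2, hy3⟩ := (h2.and ((ae_cond_class hclass hh c').and
        (cond_absolutelyContinuous.ae_le hfv))).exists
      have := hy1 (by rw [Set.mem_ofPred_eq, hy2]; exact hc')
      rw [hx, hy3, hy2, inner_eq_of_norm_eq hτ (hv _) (hv _), ← hcm] at this
      exact this
  have hinner : ∀ᵐ x ∂p, ∫ x', φ (hardest p h f x - inner ℝ (f x) (f x')) ∂(posDist p h x) =
      φ (-(classMargin v (h x) ^ 2) / 2) := by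
    filter_upwards [hfv, hhard] with x hx hhx
    have := isProbabilityMeasure_posDist p hclass x
    have hc : ∫ x', φ (hardest p h f x - inner ℝ (f x) (f x')) ∂(posDist p h x) =
        ∫ _, φ (-(classMargin v (h x) ^ 2) / 2) ∂(posDist p h x) := by
      refine integral_congr_ae ?_
      filter_upwards [ae_cond_class hclass hh (h x), cond_absolutelyContinuous.ae_le hfv]
        with x' h1 h2
      rw [hhx, hx, h2, h1, inner_eq_of_norm_eq hτ (hv _) (hv _)]
      congr 1
      simp
      ring
    rw [hc]
    simp
  rw [pairLoss, integral_congr_ae hinner, integral_eq_sum_cond hh, gapCost]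
  · refine Finset.sum_congr rfl fun c _ => ?_
    congr 1
    have : ∫ x, φ (-(classMargin v (h x) ^ 2) / 2) ∂(cond p {y | h y = c}) =
        ∫ _, φ (-(classMargin v c ^ 2) / 2) ∂(cond p {y | h y = c}) := by
      refine integral_congr_ae ?_
      filter_upwards [ae_cond_class hclass hh c] with x hx
      rw [hx]
    rw [this]
    simp
  · exact (Integrable.of_finite (μ := p.map h)
      (f := fun c => φ (-(classMargin v c ^ 2) / 2))).comp_measurable hh

end Cost

section Minimisers

variable {X C : Type*} [MeasurableSpace X] [Fintype C] [Nontrivial C] [MeasurableSpace C]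
  [MeasurableSingletonClass C] {d : ℕ} {τ : ℝ} {p : Measure X} [IsProbabilityMeasure p] {h : X → C}
  {F : (X → EuclideanSpace ℝ (Fin d)) → ℝ} {K : (C → EuclideanSpace ℝ (Fin d)) → ℝ} {κ : ℝ}

theorem exists_isPacking_zero (hd : 0 < d) (hK : Continuous K) : ∃ v, IsPacking τ K 0 v := by
  obtain ⟨v, hv, hmin⟩ := (isCompact_onSphere (C := C) (d := d) τ).exists_isMinOn
    (exists_onSphere hd τ) hK.continuousOn
  exact ⟨v, hv, fun v' hv' => by simpa using hmin hv'⟩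

theorem isEmbedding_comp_class (hτ : 0 < τ) (hh : Measurable h)
    {v : C → EuclideanSpace ℝ (Fin d)} (hv : OnSphere τ v) : IsEmbedding fun x => v (h x) := by
  refine ⟨(measurable_of_finite v).comp hh, fun x => norm_pos_iff.1 ?_⟩
  rw [hv]
  exact one_div_pos.2 (Real.sqrt_pos.2 hτ)

/-- A misclassified point is at distance at least half the margin from its representative. -/
theorem risk_mul_sq_margin_le (hh : Measurable h) {f : X → EuclideanSpace ℝ (Fin d)}
    (hf : Measurable f) (hn : ∀ x, ‖f x‖ = 1 / √τ)
    {v : C → EuclideanSpace ℝ (Fin d)} (hv : OnSphere τ v) {hhat : X → C}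
    (hnn : IsNearestNeighbour f v hhat) :
    risk p h hhat * margin v ^ 2 ≤ 4 * ∫ x, ‖f x - v (h x)‖ ^ 2 ∂p := by
  have hint := integrable_sq_dist hh hf hn hv p
  have hsub : {x | hhat x ≠ h x} ⊆ {x | margin v ^ 2 / 4 ≤ ‖f x - v (h x)‖ ^ 2} := by
    intro x hx
    have h1 : margin v ≤ ‖v (h x) - v (hhat x)‖ := margin_le hx
    have h2 : ‖v (h x) - v (hhat x)‖ ≤ ‖f x - v (h x)‖ + ‖f x - v (hhat x)‖ := by
      rw [norm_sub_rev (f x) (v (h x))]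
      exact norm_sub_le_norm_sub_add_norm_sub _ _ _
    have h3 := hnn x (h x)
    have h4 : margin v / 2 ≤ ‖f x - v (h x)‖ := by linarith
    have h5 := pow_le_pow_left₀ (div_nonneg (margin_nonneg v) zero_le_two) h4 2
    change margin v ^ 2 / 4 ≤ _
    linarith
  have hrisk : risk p h hhat ≤ p.real {x | margin v ^ 2 / 4 ≤ ‖f x - v (h x)‖ ^ 2} :=
    measureReal_mono hsub
  have hmarkov := mul_meas_ge_le_integral_of_nonneg (μ := p)
    (ae_of_all _ fun x => by positivity) hint (margin v ^ 2 / 4)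
  have := mul_le_mul_of_nonneg_left hrisk (sq_nonneg (margin v))
  linarith

/-- Almost optimal packings inherit a lower bound on the margin from the optimal ones. -/
theorem exists_lt_margin_of_isPacking (hd : 0 < d) (hK : Continuous K) {ξ : ℝ}
    (hξ : ∀ v, IsPacking τ K 0 v → ξ < margin v) :
    ∃ ε₀, 0 < ε₀ ∧ ∀ ε, ε ≤ ε₀ → ∀ v, IsPacking τ K ε v → ξ < margin v := by
  obtain ⟨w, hw⟩ := exists_isPacking_zero (τ := τ) hd hK
  have hcpt : IsCompact ({v : C → EuclideanSpace ℝ (Fin d) | OnSphere τ v} ∩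
      {v | margin v ≤ ξ}) :=
    (isCompact_onSphere τ).inter_right (isClosed_le continuous_margin continuous_const)
  rcases Set.eq_empty_or_nonempty ({v : C → EuclideanSpace ℝ (Fin d) | OnSphere τ v} ∩
      {v | margin v ≤ ξ}) with he | hne
  · refine ⟨1, one_pos, fun ε _ v hv => ?_⟩
    by_contra hlt
    exact (Set.eq_empty_iff_forall_notMem.1 he v) ⟨hv.1, not_lt.1 hlt⟩
  · obtain ⟨v₁, ⟨hv₁, hm₁⟩, hmin⟩ := hcpt.exists_isMinOn hne hK.continuousOn
    have hgap : K w < K v₁ := by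
      by_contra hle
      refine absurd (hξ v₁ ⟨hv₁, fun v' hv' => ?_⟩) (not_lt.2 hm₁)
      linarith [hw.2 v' hv']
    refine ⟨(K v₁ - K w) / 2, by linarith, fun ε hε v hv => ?_⟩
    by_contra hlt
    have h1 : K v₁ ≤ K v := hmin ⟨hv.1, not_lt.1 hlt⟩
    linarith [hv.2 w hw.1]

variable (hlower : ∀ g, IsEmbedding g → ∃ v : C → EuclideanSpace ℝ (Fin d), OnSphere τ v ∧
    K v + (∫ x, ‖normalised τ g x - v (h x)‖ ^ 2 ∂p) / (2 * κ) ≤ F g)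
  (heq : ∀ g, IsEmbedding g → ∀ v, OnSphere τ v → (∀ᵐ x ∂p, normalised τ g x = v (h x)) →
    F g = K v)
include hlower heq

theorem exists_packing_of_isMinimiser (hτ : 0 < τ) (hκ : 0 < κ) (hh : Measurable h)
    {ε : ℝ} {g : X → EuclideanSpace ℝ (Fin d)} (hg : IsMinimiser F ε g) :
    ∃ v, IsPacking τ K ε v ∧ ∫ x, ‖normalised τ g x - v (h x)‖ ^ 2 ∂p ≤ 2 * κ * ε := by
  obtain ⟨v, hv, hle⟩ := hlower g hg.1
  have hcomp : ∀ v', OnSphere τ v' → F g ≤ K v' + ε := by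
    intro v' hv'
    have h1 := hg.2 _ (isEmbedding_comp_class hτ hh hv')
    rwa [heq _ (isEmbedding_comp_class hτ hh hv') v' hv' (ae_of_all _ fun x => by
      rw [normalised_eq_self hτ fun x => hv' (h x)])] at h1
  have hD : 0 ≤ ∫ x, ‖normalised τ g x - v (h x)‖ ^ 2 ∂p := integral_nonneg fun x => by positivity
  have hD' : 0 ≤ (∫ x, ‖normalised τ g x - v (h x)‖ ^ 2 ∂p) / (2 * κ) := by positivity
  refine ⟨v, ⟨hv, fun v' hv' => by linarith [hcomp v' hv']⟩, ?_⟩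
  have h2 : (∫ x, ‖normalised τ g x - v (h x)‖ ^ 2 ∂p) / (2 * κ) ≤ ε := by
    linarith [hcomp v hv]
  rw [div_le_iff₀ (by positivity)] at h2
  linarith

theorem minimisersArePackings_of_bounds (hτ : 0 < τ) (hκ : 0 < κ) (hd : 0 < d)
    (hh : Measurable h) (hK : Continuous K) : MinimisersArePackings p h τ F K := by
  have hmin : ∀ g, IsEmbedding g → ∀ v, IsPacking τ K 0 v →
      (∀ᵐ x ∂p, normalised τ g x = v (h x)) → IsMinimiser F 0 g := by
    intro g hg v hv hgv
    refine ⟨hg, fun g' hg' => ?_⟩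
    obtain ⟨v', hv', hle⟩ := hlower g' hg'
    have hD : 0 ≤ (∫ x, ‖normalised τ g' x - v' (h x)‖ ^ 2 ∂p) / (2 * κ) :=
      div_nonneg (integral_nonneg fun x => by positivity) (by positivity)
    rw [heq g hg v hv.1 hgv]
    linarith [hv.2 v' hv']
  refine ⟨?_, fun g hg => ⟨fun hgm => ?_, fun ⟨v, hv, hgv⟩ => hmin g hg v hv hgv⟩⟩
  · obtain ⟨v, hv⟩ := exists_isPacking_zero (τ := τ) hd hK
    refine ⟨_, hmin _ (isEmbedding_comp_class hτ hh hv.1) v hv (ae_of_all _ fun x => ?_)⟩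
    rw [normalised_eq_self hτ fun x => hv.1 (h x)]
  · obtain ⟨v, hv, hD⟩ := exists_packing_of_isMinimiser hlower heq hτ hκ hh hgm
    refine ⟨v, hv, ?_⟩
    have hint := integrable_sq_dist hh (measurable_normalised hg.measurable)
      (norm_normalised hτ hg.ne_zero) hv.1 p
    have h0 : ∫ x, ‖normalised τ g x - v (h x)‖ ^ 2 ∂p = 0 :=
      le_antisymm (by simpa using hD) (integral_nonneg fun x => by positivity)
    rw [integral_eq_zero_iff_of_nonneg (fun x => by positivity) hint] at h0
    filter_upwards [h0] with x hx
    have : ‖normalised τ g x - v (h x)‖ = 0 := by simpa using hx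
    exact sub_eq_zero.1 (norm_eq_zero.1 this)

theorem riskBound_of_bounds (hτ : 0 < τ) (hκ : 0 < κ) (hh : Measurable h) :
    RiskBound p h τ F K κ := by
  intro ε _ g hg
  obtain ⟨v, hv, hD⟩ := exists_packing_of_isMinimiser hlower heq hτ hκ hh hg
  refine ⟨v, hv, fun hhat hnn => ?_⟩
  have := risk_mul_sq_margin_le (p := p) hh (measurable_normalised hg.1.measurable)
    (norm_normalised hτ hg.1.ne_zero) hv.1 hnn
  linarith

theorem uniformRiskBound_of_bounds (hτ : 0 < τ) (hκ : 0 < κ) (hd : 0 < d) (hh : Measurable h)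
    (hK : Continuous K) : UniformRiskBound p h τ F K κ := by
  intro ξ hξ0 hξ
  obtain ⟨ε₀, hε₀, hmargin⟩ := exists_lt_margin_of_isPacking hd hK hξ
  refine ⟨ε₀, hε₀, fun ε hε hle g hg => ?_⟩
  obtain ⟨v, hv, hrisk⟩ := riskBound_of_bounds hlower heq hτ hκ hh ε hε g hg
  refine ⟨v, hv, fun hhat hnn => ?_⟩
  rw [le_div_iff₀ (by positivity)]
  refine le_trans ?_ (hrisk hhat hnn)
  exact mul_le_mul_of_nonneg_left
    (pow_le_pow_left₀ hξ0.le (hmargin ε hle v hv).le 2) measureReal_nonneg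

end Minimisers

section Softplus

/-- The loss `log (1 + Q e^t)` of a pair as a function of the gap `t`. -/
def softplus (Q t : ℝ) : ℝ := Real.log (1 + Q * Real.exp t)

variable {Q : ℝ}

theorem one_add_mul_exp_pos (hQ : 0 < Q) (t : ℝ) : 0 < 1 + Q * Real.exp t := by positivity

theorem monotone_softplus (hQ : 0 < Q) : Monotone (softplus Q) := fun s t hst =>
  Real.log_le_log (one_add_mul_exp_pos hQ s)
    (by gcongr)

theorem continuous_softplus (hQ : 0 < Q) : Continuous (softplus Q) :=
  (continuous_const.add (continuous_const.mul Real.continuous_exp)).log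
    fun t => (one_add_mul_exp_pos hQ t).ne'

theorem neg_log_div_eq_softplus (hQ : 0 < Q) {E : ℝ} (hE : 0 < E) (s : ℝ) :
    -Real.log (Real.exp s / (Real.exp s + Q * E)) = softplus Q (Real.log E - s) := by
  rw [softplus, Real.exp_sub, Real.exp_log hE, ← Real.log_inv]
  congr 1
  field_simp

theorem softplus_add_div_le (hQ : 0 < Q) {B t s : ℝ} (ht : -B ≤ t) (hs : 0 ≤ s) :
    softplus Q t + s / (1 + Real.exp B / Q) ≤ softplus Q (t + s) := by
  have hp := one_add_mul_exp_pos hQ t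
  set b := Q * Real.exp t / (1 + Q * Real.exp t) with hb
  have hb0 : 0 ≤ b := by positivity
  have hsum : 1 / (1 + Q * Real.exp t) + b = 1 := by rw [hb]; field_simp
  have hslope : s / (1 + Real.exp B / Q) ≤ b * s := by
    have h1 : 1 ≤ Real.exp t * Real.exp B := by
      rw [← Real.exp_add]; exact Real.one_le_exp (by linarith)
    have h2 : 1 / (1 + Real.exp B / Q) ≤ b := by
      rw [hb, div_le_div_iff₀ (by positivity) hp]
      have : Q * Real.exp t * (1 + Real.exp B / Q) =
          Q * Real.exp t + Real.exp t * Real.exp B := by field_simp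
      rw [this]
      linarith
    calc s / (1 + Real.exp B / Q) = 1 / (1 + Real.exp B / Q) * s := by ring
      _ ≤ b * s := mul_le_mul_of_nonneg_right h2 hs
  have hconv := convexOn_exp.2 (Set.mem_univ 0) (Set.mem_univ s)
    (one_div_pos.2 hp).le hb0 hsum
  simp only [smul_eq_mul, mul_zero, zero_add, Real.exp_zero, mul_one] at hconv
  have hexp : (1 + Q * Real.exp t) * Real.exp (b * s) ≤ 1 + Q * Real.exp (t + s) := by
    calc (1 + Q * Real.exp t) * Real.exp (b * s)
        ≤ (1 + Q * Real.exp t) * (1 / (1 + Q * Real.exp t) + b * Real.exp s) :=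
          mul_le_mul_of_nonneg_left hconv hp.le
      _ = 1 + Q * Real.exp (t + s) := by rw [hb, Real.exp_add]; field_simp
  calc softplus Q t + s / (1 + Real.exp B / Q) ≤ softplus Q t + b * s := by linarith
    _ = Real.log ((1 + Q * Real.exp t) * Real.exp (b * s)) := by
        rw [Real.log_mul hp.ne' (Real.exp_pos _).ne', Real.log_exp, softplus]
    _ ≤ _ := Real.log_le_log (by positivity) hexp

theorem add_log_le_softplus (hQ : 0 < Q) (t : ℝ) : t + Real.log Q ≤ softplus Q t := by
  rw [softplus, Real.le_log_iff_exp_le (one_add_mul_exp_pos hQ t), Real.exp_add, Real.exp_log hQ]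
  linarith

theorem softplus_le_add_log (hQ : 0 < Q) {B t : ℝ} (ht : -B ≤ t) :
    softplus Q t ≤ t + (Real.log Q + Real.exp B / Q) := by
  rw [softplus, Real.log_le_iff_le_exp (one_add_mul_exp_pos hQ t), Real.exp_add, Real.exp_add,
    Real.exp_log hQ]
  have h1 := Real.add_one_le_exp (Real.exp B / Q)
  have h2 : 1 ≤ Real.exp t * Real.exp B := by
    rw [← Real.exp_add]; exact Real.one_le_exp (by linarith)
  calc 1 + Q * Real.exp t ≤ Real.exp t * Real.exp B + Q * Real.exp t := by linarith
    _ = Real.exp t * (Q * (Real.exp B / Q + 1)) := by field_simp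
    _ ≤ _ := by gcongr

end Softplus

section ClassifierBase

variable {X Z C : Type*} [MeasurableSpace X] [MeasurableSpace Z] {ν : Measure X} {gp : X → Z}
  {score : Z → C → ℝ}

theorem isFiniteMeasure_classifierBase {c : C}
    (hint : Integrable (fun y => Real.sigmoid (score (gp y) c)) ν) :
    IsFiniteMeasure (classifierBase ν gp score c) :=
  isFiniteMeasure_withDensity_ofReal hint.2

theorem absolutelyContinuous_classifierBase (hgp : Measurable gp) {c : C}
    (hscore : Measurable fun z => score z c) : ν ≪ classifierBase ν gp score c := by
  refine withDensity_absolutelyContinuous' ?_ (ae_of_all _ fun y => ?_)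
  · exact (ENNReal.measurable_ofReal.comp
      (continuous_sigmoid.measurable.comp (hscore.comp hgp))).aemeasurable
  · exact (ENNReal.ofReal_pos.2 (Real.sigmoid_pos _)).ne'

end ClassifierBase

section Losses

variable {X C : Type*} [MeasurableSpace X] [Fintype C] [Nontrivial C] [MeasurableSpace C]
  [MeasurableSingletonClass C] {d : ℕ} {p : Measure X} [IsProbabilityMeasure p] {h : X → C}
  {f : X → EuclideanSpace ℝ (Fin d)} {Q : ℝ}

theorem contrastiveLoss_eq_pairLoss (hQ : 0 < Q) {q : X → Measure X}
    (hq : ∀ x, 0 < ∫ y, Real.exp (inner ℝ (f x) (f y)) ∂(q x)) :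
    contrastiveLoss p h Q f q = pairLoss (softplus Q) p h f (logNeg f q) := by
  simp_rw [contrastiveLoss, pairLoss, neg_log_div_eq_softplus hQ (hq _), logNeg]

theorem sharpLoss_zero_eq_contrastiveLoss {Z : Type*} (ν : Measure X) (gp : X → Z)
    (score : Z → C → ℝ) (τ β : ℝ) (g : X → EuclideanSpace ℝ (Fin d)) :
    sharpLoss p ν h gp score τ Q 1 0 β g = contrastiveLoss p h Q (normalised τ g)
      (hardNeg (classifierBase ν gp score) h (normalised τ g) β) := by
  simp [sharpLoss, contrastiveLoss, posTerm, negTerm]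

theorem hardNeg_eq_of_eq_smul (hclass : ∀ c, p {x | h x = c} ≠ 0) {base : C → Measure X}
    [∀ c, IsFiniteMeasure (base c)] (hpb : ∀ c, p ≪ base c)
    (hk : ∀ c, ∃ k : ENNReal, base c = k • p) (β : ℝ) :
    hardNeg base h f β = hardNeg (fun _ => p) h f β := by
  funext x
  obtain ⟨k, hk⟩ := hk (h x)
  have hk0 : k ≠ 0 := by
    rintro rfl
    refine hclass (h x) (hpb (h x) ?_)
    simp [hk]
  have hktop : k ≠ ⊤ := by
    have := measure_ne_top (base (h x)) Set.univ
    rw [hk] at this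
    simpa using this
  rw [hardNeg, hardNeg, hk, Measure.restrict_smul, tilted_smul_measure _ _ hk0 hktop]

theorem neg_log_div_add_nonneg {a b : ℝ} (ha : 0 < a) (hb : 0 ≤ b) :
    0 ≤ -Real.log (a / (a + b)) := by
  rw [Left.nonneg_neg_iff]
  exact Real.log_nonpos (by positivity) ((div_le_one (by positivity)).2 (by linarith))

theorem neg_log_div_add_anti {a a' b : ℝ} (ha : 0 < a) (haa' : a ≤ a') (hb : 0 ≤ b) :
    -Real.log (a' / (a' + b)) ≤ -Real.log (a / (a + b)) := by
  have ha' := ha.trans_le haa'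
  refine neg_le_neg (Real.log_le_log (by positivity) ?_)
  rw [div_le_div_iff₀ (by positivity) (by positivity)]
  nlinarith

theorem exp_le_posTerm {α : ℝ} (hα : 0 ≤ α) (x x' : X) :
    Real.exp (inner ℝ (f x) (f x')) ≤ posTerm p h f α x x' :=
  le_add_of_nonneg_right (mul_nonneg hα (integral_nonneg fun _ => (Real.exp_pos _).le))

theorem negTerm_nonneg (hQ : 0 < Q) (γ : ℝ) (q : X → Measure X) (x : X) :
    0 ≤ negTerm f Q γ q x :=
  mul_nonneg hQ.le (integral_nonneg fun _ => (Real.exp_pos _).le)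

theorem integral_exp_mul_mem_Icc {μ : Measure X} [IsProbabilityMeasure μ] {u : X → ℝ} {B : ℝ}
    (hu : Measurable u) (hB : ∀ y, |u y| ≤ B) (γ : ℝ) :
    ∫ y, Real.exp (γ * u y) ∂μ ∈ Set.Icc (Real.exp (-(|γ| * B))) (Real.exp (|γ| * B)) := by
  have hint := integrable_exp_mul_of_abs_le (μ := μ) hu hB γ
  have hbound : ∀ y, |γ * u y| ≤ |γ| * B := fun y => by
    rw [abs_mul]; exact mul_le_mul_of_nonneg_left (hB y) (abs_nonneg _)
  constructor
  · calc Real.exp (-(|γ| * B)) = ∫ _, Real.exp (-(|γ| * B)) ∂μ := by simp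
      _ ≤ _ := integral_mono (integrable_const _) hint fun y =>
          Real.exp_le_exp.2 (abs_le.1 (hbound y)).1
  · calc ∫ y, Real.exp (γ * u y) ∂μ ≤ ∫ _, Real.exp (|γ| * B) ∂μ :=
          integral_mono hint (integrable_const _) fun y =>
            Real.exp_le_exp.2 (abs_le.1 (hbound y)).2
      _ = _ := by simp

/-- Additional positives can only decrease the loss. -/
theorem sharp_integral_le (hclass : ∀ c, p {x | h x = c} ≠ 0) {base : C → Measure X}
    [∀ c, IsFiniteMeasure (base c)] (hpb : ∀ c, p ≪ base c) (hh : Measurable h)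
    (hf : Measurable f) {R : ℝ} (hR : ∀ x y, |inner ℝ (f x) (f y)| ≤ R) (hQ : 0 < Q) {α : ℝ}
    (hα : 0 ≤ α) (β γ : ℝ) :
    ∫ x, ∫ x', -Real.log (posTerm p h f α x x' /
      (posTerm p h f α x x' + negTerm f Q γ (hardNeg base h f β) x)) ∂(posDist p h x) ∂p ≤
    ∫ x, ∫ x', -Real.log (posTerm p h f 0 x x' /
      (posTerm p h f 0 x x' + negTerm f Q γ (hardNeg base h f β) x)) ∂(posDist p h x) ∂p := by
  set E : X → ℝ := fun x =>
    ∫ y, Real.exp (γ * inner ℝ (f x) (f y)) ∂(hardNeg base h f β x) with hE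
  have hmem : ∀ x, E x ∈ Set.Icc (Real.exp (-(|γ| * R))) (Real.exp (|γ| * R)) := by
    intro x
    have := neZero_restrict_ne_class hclass (hpb (h x)) (h x)
    have : IsProbabilityMeasure (hardNeg base h f β x) :=
      isProbabilityMeasure_tilted
        (integrable_exp_mul_of_abs_le (measurable_const.inner hf) (hR x) β)
    exact integral_exp_mul_mem_Icc (measurable_const.inner hf) (hR x) γ
  have hpos : ∀ x, 0 < E x := fun x => (Real.exp_pos _).trans_le (hmem x).1
  have hrw : ∀ x x', -Real.log (posTerm p h f 0 x x' /
      (posTerm p h f 0 x x' + negTerm f Q γ (hardNeg base h f β) x)) =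
      softplus Q (Real.log (E x) - inner ℝ (f x) (f x')) := by
    intro x x'
    rw [← neg_log_div_eq_softplus hQ (hpos x)]
    simp [posTerm, negTerm, hE]
  have hR' : ∀ x y, |inner ℝ (f x) (f y)| ≤ max R (|γ| * R) := fun x y =>
    (hR x y).trans (le_max_left _ _)
  have hlog : ∀ x, |Real.log (E x)| ≤ max R (|γ| * R) := by
    intro x
    refine le_trans (abs_le.2 ⟨?_, ?_⟩) (le_max_right _ _)
    · rw [Real.le_log_iff_exp_le (hpos x)]; exact (hmem x).1
    · rw [Real.log_le_iff_le_exp (hpos x)]; exact (hmem x).2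
  have hmE : Measurable fun x => Real.log (E x) :=
    Real.measurable_log.comp (measurable_integral_exp_hardNeg hh hf γ β)
  have hnonneg : ∀ x x', 0 ≤ -Real.log (posTerm p h f α x x' /
      (posTerm p h f α x x' + negTerm f Q γ (hardNeg base h f β) x)) := fun x x' =>
    neg_log_div_add_nonneg ((Real.exp_pos _).trans_le (exp_le_posTerm hα x x'))
      (negTerm_nonneg hQ γ _ x)
  have hle : ∀ x x', -Real.log (posTerm p h f α x x' /
      (posTerm p h f α x x' + negTerm f Q γ (hardNeg base h f β) x)) ≤
      softplus Q (Real.log (E x) - inner ℝ (f x) (f x')) := by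
    intro x x'
    rw [← hrw]
    refine neg_log_div_add_anti ((Real.exp_pos _).trans_le (exp_le_posTerm le_rfl x x')) ?_
      (negTerm_nonneg hQ γ _ x)
    refine le_trans (le_of_eq ?_) (exp_le_posTerm hα x x')
    simp [posTerm]
  simp_rw [hrw]
  refine integral_mono_of_nonneg (ae_of_all _ fun x => integral_nonneg (hnonneg x))
    (integrable_integral_gap hclass hh (monotone_softplus hQ) (continuous_softplus hQ) hf hR'
      hmE hlog) (ae_of_all _ fun x => ?_)
  have := isProbabilityMeasure_posDist p hclass x
  exact integral_mono_of_nonneg (ae_of_all _ (hnonneg x))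
    (integrable_gap (monotone_softplus hQ) (continuous_softplus hQ) hf hR' (hlog x) _)
    (ae_of_all _ (hle x))

theorem pairLoss_le_of_le (hclass : ∀ c, p {x | h x = c} ≠ 0) (hh : Measurable h)
    {φ ψ : ℝ → ℝ} (hφ : Monotone φ) (hφc : Continuous φ) (hψ : Monotone ψ) (hψc : Continuous ψ)
    (hf : Measurable f) {R : ℝ} (hR : ∀ x y, |inner ℝ (f x) (f y)| ≤ R) {m : X → ℝ}
    (hm : Measurable m) (hmR : ∀ x, |m x| ≤ R) (hle : ∀ t, -(2 * R) ≤ t → φ t ≤ ψ t) :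
    pairLoss φ p h f m ≤ pairLoss ψ p h f m := by
  refine integral_mono (integrable_integral_gap hclass hh hφ hφc hf hR hm hmR)
    (integrable_integral_gap hclass hh hψ hψc hf hR hm hmR) fun x => ?_
  have := isProbabilityMeasure_posDist p hclass x
  refine integral_mono (integrable_gap hφ hφc hf hR (hmR x) _)
    (integrable_gap hψ hψc hf hR (hmR x) _) fun x' => hle _ ?_
  have h1 := (abs_le.1 (hR x x')).2
  have h2 := (abs_le.1 (hmR x)).1
  linarith

theorem pairLoss_add_const (hclass : ∀ c, p {x | h x = c} ≠ 0) (hh : Measurable h)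
    {φ : ℝ → ℝ} (hφ : Monotone φ) (hφc : Continuous φ)
    (hf : Measurable f) {R : ℝ} (hR : ∀ x y, |inner ℝ (f x) (f y)| ≤ R) {m : X → ℝ}
    (hm : Measurable m) (hmR : ∀ x, |m x| ≤ R) (k : ℝ) :
    pairLoss (fun t => φ t + k) p h f m = pairLoss φ p h f m + k := by
  have hinner : ∀ x, ∫ x', (φ (m x - inner ℝ (f x) (f x')) + k) ∂(posDist p h x) =
      (∫ x', φ (m x - inner ℝ (f x) (f x')) ∂(posDist p h x)) + k := by
    intro x
    have := isProbabilityMeasure_posDist p hclass x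
    rw [integral_add (integrable_gap hφ hφc hf hR (hmR x) _) (integrable_const _)]
    simp
  simp_rw [pairLoss, hinner]
  rw [integral_add (integrable_integral_gap hclass hh hφ hφc hf hR hm hmR) (integrable_const _)]
  simp

theorem tendsto_pairLoss_softplus_sub_log (hclass : ∀ c, p {x | h x = c} ≠ 0)
    (hh : Measurable h) (hf : Measurable f) {R : ℝ} (hR : ∀ x y, |inner ℝ (f x) (f y)| ≤ R)
    {m : X → ℝ} (hm : Measurable m) (hmR : ∀ x, |m x| ≤ R) :
    Tendsto (fun Q => pairLoss (softplus Q) p h f m - Real.log Q) atTop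
      (𝓝 (pairLoss id p h f m)) := by
  have hadd : ∀ k : ℝ, pairLoss (fun t => t + k) p h f m = pairLoss id p h f m + k := fun k =>
    pairLoss_add_const hclass hh monotone_id continuous_id hf hR hm hmR k
  have hupper : Tendsto (fun Q : ℝ => pairLoss id p h f m + Real.exp (2 * R) / Q) atTop
      (𝓝 (pairLoss id p h f m)) := by
    simpa using (tendsto_const_nhds (x := pairLoss id p h f m)).add
      (tendsto_id.const_div_atTop (Real.exp (2 * R)))
  refine tendsto_of_tendsto_of_tendsto_of_le_of_le' tendsto_const_nhds hupper ?_ ?_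
  · filter_upwards [eventually_gt_atTop 0] with Q hQ
    have := pairLoss_le_of_le hclass hh (φ := fun t => t + Real.log Q)
      (monotone_id.add_const _) (by fun_prop) (monotone_softplus hQ) (continuous_softplus hQ)
      hf hR hm hmR fun t _ => add_log_le_softplus hQ t
    rw [hadd] at this
    linarith
  · filter_upwards [eventually_gt_atTop 0] with Q hQ
    have := pairLoss_le_of_le hclass hh (ψ := fun t => t + (Real.log Q + Real.exp (2 * R) / Q))
      (monotone_softplus hQ) (continuous_softplus hQ) (monotone_id.add_const _) (by fun_prop)
      hf hR hm hmR fun t ht => softplus_le_add_log hQ ht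
    rw [hadd] at this
    linarith

end Losses

end SHARP

end

theorem mainTheorem1 {X Z C : Type*} [MeasurableSpace X] [MeasurableEq X] [MeasurableSpace Z]
    [Fintype C] [Nontrivial C] [MeasurableSpace C] [MeasurableSingletonClass C]
    {d : ℕ} (hd : 0 < d) (τ : ℝ) (hτ : 0 < τ)
    (p : Measure X) [IsProbabilityMeasure p]
    (h : X → C) (hh : Measurable h) (hclass : ∀ c, p {x | h x = c} ≠ 0)
    (ν : Measure X) (hpν : p ≪ ν) (hνp : ν ≪ p)
    (gp : X → Z) (hgp : Measurable gp)
    (score : Z → C → ℝ) (hscore : ∀ c, Measurable (fun z => score z c))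
    (hint : ∀ c, Integrable (fun y => Real.sigmoid (score (gp y) c)) ν) :
    -- the SHARP objective is largest at `α = 0`, where it is an unsupervised objective
    (∀ g : X → EuclideanSpace ℝ (Fin d), SHARP.IsEmbedding g →
      ∀ Q, 0 < Q → ∀ α, 0 ≤ α → ∀ β, 0 < β →
        (∀ γ, SHARP.sharpLoss p ν h gp score τ Q γ α β g ≤
          SHARP.sharpLoss p ν h gp score τ Q γ 0 β g) ∧
        SHARP.sharpLoss p ν h gp score τ Q 1 0 β g =
          SHARP.contrastiveLoss p h Q (SHARP.normalised τ g)
            (SHARP.hardNeg (SHARP.classifierBase ν gp score) h (SHARP.normalised τ g) β) ∧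
        ((∀ c, ∃ k : ENNReal, SHARP.classifierBase ν gp score c = k • p) →
          SHARP.sharpLoss p ν h gp score τ Q 1 α β g ≤ SHARP.robinsonLoss p h τ Q β g) ∧
        SHARP.sharpLoss p ν h gp score τ Q 1 α β g ≤ SHARP.robinsonWorst p h τ Q g) ∧
    -- the limit of hard negatives, and the limit of many negatives
    (∀ g : X → EuclideanSpace ℝ (Fin d), SHARP.IsEmbedding g →
      (∀ Q, 0 < Q →
        SHARP.sharpWorst p ν h gp score τ Q g = SHARP.robinsonWorst p h τ Q g ∧
        Tendsto (fun β => SHARP.sharpLoss p ν h gp score τ Q 1 0 β g) atTop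
          (𝓝 (SHARP.sharpWorst p ν h gp score τ Q g)) ∧
        Tendsto (fun β => SHARP.robinsonLoss p h τ Q β g) atTop
          (𝓝 (SHARP.robinsonWorst p h τ Q g))) ∧
      Tendsto (fun Q => SHARP.sharpWorst p ν h gp score τ Q g - Real.log Q) atTop
        (𝓝 (SHARP.sharpWorstLimit p ν h gp score τ g))) ∧
    -- packings and misclassification risk for the worst-case objective
    (∀ Q, 0 < Q →
      SHARP.MinimisersArePackings (d := d) p h τ (SHARP.sharpWorst p ν h gp score τ Q)
        (SHARP.packingCost p h Q) ∧
      SHARP.RiskBound (d := d) p h τ (SHARP.sharpWorst p ν h gp score τ Q)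
        (SHARP.packingCost p h Q) (1 + Real.exp (2 / τ) / Q) ∧
      SHARP.UniformRiskBound (d := d) p h τ (SHARP.sharpWorst p ν h gp score τ Q)
        (SHARP.packingCost p h Q) (1 + Real.exp (2 / τ) / Q)) ∧
    -- the same in the limit of many negatives
    SHARP.MinimisersArePackings (d := d) p h τ (SHARP.sharpWorstLimit p ν h gp score τ)
      (SHARP.packingCostLimit p h) ∧
    SHARP.RiskBound (d := d) p h τ (SHARP.sharpWorstLimit p ν h gp score τ)
      (SHARP.packingCostLimit p h) 1 ∧
    SHARP.UniformRiskBound (d := d) p h τ (SHARP.sharpWorstLimit p ν h gp score τ)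
      (SHARP.packingCostLimit p h) 1 := by
  have hfin : ∀ c, IsFiniteMeasure (SHARP.classifierBase ν gp score c) := fun c =>
    SHARP.isFiniteMeasure_classifierBase (hint c)
  have hpb : ∀ c, p ≪ SHARP.classifierBase ν gp score c := fun c =>
    hpν.trans (SHARP.absolutelyContinuous_classifierBase hgp (hscore c))
  have hbp : ∀ c, SHARP.classifierBase ν gp score c ≪ p := fun c =>
    (withDensity_absolutelyContinuous _ _).trans hνp
  have hpp : ∀ _ : C, p ≪ p := fun _ => Measure.AbsolutelyContinuous.rfl
  have hn : ∀ {g : X → EuclideanSpace ℝ (Fin d)}, SHARP.IsEmbedding g →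
      ∀ x, ‖SHARP.normalised τ g x‖ = 1 / √τ := fun hg => SHARP.norm_normalised hτ hg.ne_zero
  have hf : ∀ {g : X → EuclideanSpace ℝ (Fin d)}, SHARP.IsEmbedding g →
      Measurable (SHARP.normalised τ g) := fun hg => SHARP.measurable_normalised hg.measurable
  have hR : ∀ {g : X → EuclideanSpace ℝ (Fin d)}, SHARP.IsEmbedding g → ∀ x y,
      |inner ℝ (SHARP.normalised τ g x) (SHARP.normalised τ g y)| ≤ 1 / τ := fun hg x y =>
    SHARP.abs_inner_le_of_norm_eq hτ (hn hg x) (hn hg y)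
  have hsharp : ∀ g : X → EuclideanSpace ℝ (Fin d), SHARP.IsEmbedding g → ∀ Q, 0 < Q → ∀ β,
      SHARP.sharpLoss p ν h gp score τ Q 1 0 β g =
        SHARP.pairLoss (SHARP.softplus Q) p h (SHARP.normalised τ g)
          (SHARP.logNeg (SHARP.normalised τ g)
            (SHARP.hardNeg (SHARP.classifierBase ν gp score) h (SHARP.normalised τ g) β)) := by
    intro g hg Q hQ β
    rw [SHARP.sharpLoss_zero_eq_contrastiveLoss, SHARP.contrastiveLoss_eq_pairLoss hQ
      (SHARP.integral_exp_hardNeg_pos hclass hpb (hf hg) (hR hg) β)]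
  have hrob : ∀ g : X → EuclideanSpace ℝ (Fin d), SHARP.IsEmbedding g → ∀ Q, 0 < Q → ∀ β,
      SHARP.robinsonLoss p h τ Q β g =
        SHARP.pairLoss (SHARP.softplus Q) p h (SHARP.normalised τ g)
          (SHARP.logNeg (SHARP.normalised τ g)
            (SHARP.hardNeg (fun _ => p) h (SHARP.normalised τ g) β)) := by
    intro g hg Q hQ β
    rw [SHARP.robinsonLoss, SHARP.contrastiveLoss_eq_pairLoss hQ
      (SHARP.integral_exp_hardNeg_pos hclass hpp (hf hg) (hR hg) β)]
  have hsharpWorst : ∀ g : X → EuclideanSpace ℝ (Fin d), SHARP.IsEmbedding g → ∀ Q, 0 < Q →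
      SHARP.sharpWorst p ν h gp score τ Q g =
        SHARP.pairLoss (SHARP.softplus Q) p h (SHARP.normalised τ g)
          (SHARP.hardest p h (SHARP.normalised τ g)) := by
    intro g hg Q hQ
    simp_rw [SHARP.sharpWorst, hsharp g hg Q hQ]
    exact SHARP.iSup_pairLoss_logNeg hclass hpb hbp (SHARP.monotone_softplus hQ)
      (SHARP.continuous_softplus hQ) hh (hf hg) (hR hg)
  have hrobWorst : ∀ g : X → EuclideanSpace ℝ (Fin d), SHARP.IsEmbedding g → ∀ Q, 0 < Q →
      SHARP.robinsonWorst p h τ Q g =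
        SHARP.pairLoss (SHARP.softplus Q) p h (SHARP.normalised τ g)
          (SHARP.hardest p h (SHARP.normalised τ g)) := by
    intro g hg Q hQ
    simp_rw [SHARP.robinsonWorst, hrob g hg Q hQ]
    exact SHARP.iSup_pairLoss_logNeg hclass hpp hpp (SHARP.monotone_softplus hQ)
      (SHARP.continuous_softplus hQ) hh (hf hg) (hR hg)
  have hlimit : ∀ g : X → EuclideanSpace ℝ (Fin d), SHARP.IsEmbedding g →
      SHARP.sharpWorstLimit p ν h gp score τ g =
      SHARP.pairLoss id p h (SHARP.normalised τ g)
        (SHARP.hardest p h (SHARP.normalised τ g)) := by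
    intro g hg
    rw [← SHARP.iSup_pairLoss_logNeg hclass hpb hbp monotone_id continuous_id hh (hf hg) (hR hg)]
    refine iSup_congr fun β => ?_
    simp_rw [SHARP.pairLoss, SHARP.logNeg]
    congr 1 with x
    congr 1 with x'
    rw [Real.log_div (Real.exp_pos _).ne'
      (SHARP.integral_exp_hardNeg_pos hclass hpb (hf hg) (hR hg) β x).ne', Real.log_exp, neg_sub]
    rfl
  have hαle : ∀ g : X → EuclideanSpace ℝ (Fin d), SHARP.IsEmbedding g →
      ∀ Q, 0 < Q → ∀ α, 0 ≤ α → ∀ β γ,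
      SHARP.sharpLoss p ν h gp score τ Q γ α β g ≤
        SHARP.sharpLoss p ν h gp score τ Q γ 0 β g := fun g hg Q hQ α hα β γ =>
    SHARP.sharp_integral_le hclass hpb hh (hf hg) (hR hg) hQ hα β γ
  have hcost : ∀ Q, SHARP.packingCost (d := d) p h Q =
      SHARP.gapCost (SHARP.softplus Q) p h := fun Q => rfl
  have hcostLimit : SHARP.packingCostLimit (d := d) p h = SHARP.gapCost id p h := by
    funext v
    rw [SHARP.packingCostLimit, SHARP.gapCost, ← Finset.sum_neg_distrib, Finset.sum_div]
    refine Finset.sum_congr rfl fun c _ => ?_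
    rw [id]
    ring
  refine ⟨?_, ?_, ?_, ?_⟩
  · intro g hg Q hQ α hα β hβ
    refine ⟨hαle g hg Q hQ α hα β, SHARP.sharpLoss_zero_eq_contrastiveLoss _ _ _ _ _ _,
      fun hk => (hαle g hg Q hQ α hα β 1).trans (le_of_eq ?_),
      (hαle g hg Q hQ α hα β 1).trans ?_⟩
    · rw [SHARP.sharpLoss_zero_eq_contrastiveLoss, SHARP.robinsonLoss,
        SHARP.hardNeg_eq_of_eq_smul hclass hpb hk]
    · rw [hsharp g hg Q hQ, hrobWorst g hg Q hQ]
      exact SHARP.pairLoss_logNeg_le hclass hpb hbp (SHARP.monotone_softplus hQ)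
        (SHARP.continuous_softplus hQ) hh (hf hg) (hR hg) β
  · intro g hg
    refine ⟨fun Q hQ => ⟨?_, ?_, ?_⟩, ?_⟩
    · rw [hsharpWorst g hg Q hQ, hrobWorst g hg Q hQ]
    · simp_rw [hsharp g hg Q hQ, hsharpWorst g hg Q hQ]
      exact SHARP.tendsto_pairLoss_logNeg hclass hpb hbp (SHARP.monotone_softplus hQ)
        (SHARP.continuous_softplus hQ) hh (hf hg) (hR hg)
    · simp_rw [hrob g hg Q hQ, hrobWorst g hg Q hQ]
      exact SHARP.tendsto_pairLoss_logNeg hclass hpp hpp (SHARP.monotone_softplus hQ)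
        (SHARP.continuous_softplus hQ) hh (hf hg) (hR hg)
    · rw [hlimit g hg]
      refine (SHARP.tendsto_pairLoss_softplus_sub_log hclass hh (hf hg) (hR hg)
        (SHARP.measurable_hardest hclass hh (hf hg) (hR hg))
        (SHARP.abs_hardest_le hclass (hR hg))).congr' ?_
      filter_upwards [eventually_gt_atTop 0] with Q hQ
      rw [hsharpWorst g hg Q hQ]
  · intro Q hQ
    have hκ : 0 < 1 + Real.exp (2 / τ) / Q := by positivity
    have hK : Continuous (SHARP.packingCost (d := d) p h Q) := by
      rw [hcost]
      exact SHARP.continuous_gapCost (SHARP.continuous_softplus hQ)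
    have hlower : ∀ g : X → EuclideanSpace ℝ (Fin d), SHARP.IsEmbedding g →
        ∃ v : C → EuclideanSpace ℝ (Fin d), SHARP.OnSphere τ v ∧ SHARP.packingCost p h Q v +
          (∫ x, ‖SHARP.normalised τ g x - v (h x)‖ ^ 2 ∂p) / (2 * (1 + Real.exp (2 / τ) / Q)) ≤
            SHARP.sharpWorst p ν h gp score τ Q g := by
      intro g hg
      rw [hsharpWorst g hg Q hQ, hcost]
      exact SHARP.exists_gapCost_add_le_pairLoss hclass hτ hh (SHARP.monotone_softplus hQ)
        (SHARP.continuous_softplus hQ) (fun _ _ ht hs => SHARP.softplus_add_div_le hQ ht hs)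
        (hf hg) (hn hg)
    have heq : ∀ g : X → EuclideanSpace ℝ (Fin d), SHARP.IsEmbedding g → ∀ v, SHARP.OnSphere τ v →
        (∀ᵐ x ∂p, SHARP.normalised τ g x = v (h x)) →
        SHARP.sharpWorst p ν h gp score τ Q g = SHARP.packingCost p h Q v := by
      intro g hg v hv hgv
      rw [hsharpWorst g hg Q hQ, hcost]
      exact SHARP.pairLoss_eq_gapCost hclass hτ hh (hn hg) hv hgv
    exact ⟨SHARP.minimisersArePackings_of_bounds hlower heq hτ hκ hd hh hK,
      SHARP.riskBound_of_bounds hlower heq hτ hκ hh,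
      SHARP.uniformRiskBound_of_bounds hlower heq hτ hκ hd hh hK⟩
  · have hK : Continuous (SHARP.packingCostLimit (d := d) p h) := by
      rw [hcostLimit]
      exact SHARP.continuous_gapCost continuous_id
    have hlower : ∀ g : X → EuclideanSpace ℝ (Fin d), SHARP.IsEmbedding g →
        ∃ v : C → EuclideanSpace ℝ (Fin d), SHARP.OnSphere τ v ∧ SHARP.packingCostLimit p h v +
          (∫ x, ‖SHARP.normalised τ g x - v (h x)‖ ^ 2 ∂p) / (2 * 1) ≤
            SHARP.sharpWorstLimit p ν h gp score τ g := by
      intro g hg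
      rw [hlimit g hg, hcostLimit]
      exact SHARP.exists_gapCost_add_le_pairLoss hclass hτ hh monotone_id continuous_id
        (fun t s _ _ => by simp) (hf hg) (hn hg)
    have heq : ∀ g : X → EuclideanSpace ℝ (Fin d), SHARP.IsEmbedding g → ∀ v, SHARP.OnSphere τ v →
        (∀ᵐ x ∂p, SHARP.normalised τ g x = v (h x)) →
        SHARP.sharpWorstLimit p ν h gp score τ g = SHARP.packingCostLimit p h v := by
      intro g hg v hv hgv
      rw [hlimit g hg, hcostLimit]
      exact SHARP.pairLoss_eq_gapCost hclass hτ hh (hn hg) hv hgv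
    exact ⟨SHARP.minimisersArePackings_of_bounds hlower heq hτ one_pos hd hh hK,
      SHARP.riskBound_of_bounds hlower heq hτ one_pos hh,
      SHARP.uniformRiskBound_of_bounds hlower heq hτ one_pos hd hh hK⟩
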